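/- For a bounded function $V:\mathbb Z^2\to\mathbb R$ let $H_V=\Delta+V$ be the operator on $\ell^2(\mathbb Z^2)$ (complex-valued sequences) given by $$[H_V\psi]_{n,m}=\psi_{n-1,m}+\psi_{n+1,m}+\psi_{n,m-1}+\psi_{n,m+1}+V_{n,m}\psi_{n,m},$$ and let $\sigma(H_V)$ be its spectrum. For positive integers $p,q$, call $V$ $(p,q)$-periodic if $V_{n+p,m}=V_{n,m+q}=V_{n,m}$ for all $n,m\in\mathbb Z$. Write $\|V\|_\infty=\sup_{n,m}|V_{n,m}|$. **Theorem.** Let $p,q$ be positive integers. There is a constant $C=C_{(p,q)}>0$ such that for every $(p,q)$-periodic $V:\mathbb Z^2\to\mathbb R$ with $\|V\|_\infty\le C$: 1. $\sigma(H_V)$ has at most two connected components. 2. If at least one of $p,q$ is odd, then $\sigma(H_V)$ is a single interval, i.e. $\sigma(H_V)=[a,b]$ for some real $a<b$. 3. A gap can open only at energy $0$: every gap of $\sigma(H_V)$ is contained in $[-\|V\|_\infty,\|V\|_\infty]$. That is, if $E_1<E<E_2$ are real, $E_1,E_2\in\sigma(H_V)$ and $E\notin\sigma(H_V)$, then $|E|\le\|V\|_\infty$.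 -/

import Mathlib

open scoped ENNReal

namespace LatticeSchrodinger

/-- The Hilbert space `ℓ²(ℤ²)` of complex-valued square-summable functions on the square lattice. -/
abbrev Space : Type := lp (fun _ : ℤ × ℤ => ℂ) 2

/-- Bounded real-valued potentials `V : ℤ² → ℝ`, with norm `‖V‖ = ‖V‖_∞`.
Periodic potentials take finitely many values, so all of them are of this form
(see `IsPeriodic.memℓp_infty`). -/
abbrev Potential : Type := lp (fun _ : ℤ × ℤ => ℝ) ∞

/-- `V` is `(p, q)`-periodic: `V_{n+p,m} = V_{n,m+q} = V_{n,m}` for all `n, m`. -/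
def IsPeriodic (p q : ℕ) (V : ℤ × ℤ → ℝ) : Prop :=
  ∀ n m : ℤ, V (n + p, m) = V (n, m) ∧ V (n, m + q) = V (n, m)

/-- Every periodic function on `ℤ²` is bounded. -/
theorem IsPeriodic.memℓp_infty {p q : ℕ} (hp : 0 < p) (hq : 0 < q) {V : ℤ × ℤ → ℝ}
    (hV : IsPeriodic p q V) : Memℓp V ∞ := by
  have h1 : ∀ m : ℤ, Function.Periodic (fun n : ℤ => V (n, m)) (p : ℤ) := fun m n => (hV n m).1
  have h2 : ∀ n : ℤ, Function.Periodic (fun m : ℤ => V (n, m)) (q : ℤ) := fun n m => (hV n m).2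
  have key : ∀ x : ℤ × ℤ, V x = V (x.1 % p, x.2 % q) := by
    rintro ⟨n, m⟩
    have e1 := (h1 m).int_mul (n / p) (n % p)
    have e2 := (h2 (n % p)).int_mul (m / q) (m % q)
    simp only [Int.cast_id] at e1 e2
    have d1 : n % (p : ℤ) + n / p * p = n := by rw [mul_comm]; exact Int.emod_add_mul_ediv n p
    have d2 : m % (q : ℤ) + m / q * q = m := by rw [mul_comm]; exact Int.emod_add_mul_ediv m q
    rw [d1] at e1
    rw [d2] at e2
    exact e1.trans e2
  apply _root_.memℓp_infty
  refine Set.Finite.bddAbove ?_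
  have hfin : (Set.Ico (0 : ℤ) p ×ˢ Set.Ico (0 : ℤ) q).Finite :=
    (Set.finite_Ico _ _).prod (Set.finite_Ico _ _)
  refine (hfin.image fun x => ‖V x‖).subset ?_
  rintro _ ⟨x, rfl⟩
  refine ⟨(x.1 % p, x.2 % q), ⟨⟨Int.emod_nonneg _ (by omega), Int.emod_lt_of_pos _ (by omega)⟩,
    ⟨Int.emod_nonneg _ (by omega), Int.emod_lt_of_pos _ (by omega)⟩⟩, ?_⟩
  show ‖V (x.1 % p, x.2 % q)‖ = ‖V x‖
  rw [← key x]

/-- The translation `ψ ↦ (x ↦ ψ (x + k))` on `ℓ²(ℤ²)`. -/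
noncomputable def shift (k : ℤ × ℤ) : Space →L[ℂ] Space :=
  LinearMap.mkContinuous
    { toFun := fun ψ => ⟨fun x => ψ (x + k), by
        refine (memℓp_gen_iff (by norm_num)).2 ?_
        exact ((memℓp_gen_iff (by norm_num)).1 (lp.memℓp ψ)).comp_injective
          (add_left_injective k)⟩
      map_add' := fun _ _ => rfl
      map_smul' := fun _ _ => rfl } 1 (fun ψ => by
        rw [one_mul]
        refine lp.norm_le_of_tsum_le (by norm_num) (norm_nonneg ψ) ?_
        rw [lp.norm_rpow_eq_tsum (by norm_num) ψ]
        exact ((Equiv.addRight k).tsum_eq fun x => ‖ψ x‖ ^ (2 : ℝ≥0∞).toReal).le)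

/-- The discrete Laplacian
`[Δψ]_{n,m} = ψ_{n-1,m} + ψ_{n+1,m} + ψ_{n,m-1} + ψ_{n,m+1}` on `ℓ²(ℤ²)`
(see `laplacian_apply`). -/
noncomputable def laplacian : Space →L[ℂ] Space :=
  shift (-1, 0) + shift (1, 0) + shift (0, -1) + shift (0, 1)

/-- Multiplication by the potential, `[Vψ]_{n,m} = V_{n,m} ψ_{n,m}`. -/
noncomputable def mulPotential (V : Potential) : Space →L[ℂ] Space :=
  LinearMap.mkContinuous
    { toFun := fun ψ => ⟨fun x => (V x : ℂ) * ψ x, by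
        refine (memℓp_gen_iff (by norm_num)).2 ?_
        refine Summable.of_nonneg_of_le (fun x => by positivity) (fun x => ?_)
          (((memℓp_gen_iff (by norm_num)).1 (lp.memℓp ψ)).mul_left (‖V‖ ^ (2 : ℝ≥0∞).toReal))
        rw [← Real.mul_rpow (norm_nonneg _) (norm_nonneg _), norm_mul, Complex.norm_real]
        gcongr
        exact lp.norm_apply_le_norm (by simp) V x⟩
      map_add' := fun ψ φ => lp.ext (funext fun x => mul_add (V x : ℂ) (ψ x) (φ x))
      map_smul' := fun c ψ => lp.ext (funext fun x => mul_left_comm (V x : ℂ) c (ψ x)) } ‖V‖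
    (fun ψ => by
        refine lp.norm_le_of_forall_sum_le (by norm_num) (by positivity) fun s => ?_
        rw [Real.mul_rpow (norm_nonneg _) (norm_nonneg _)]
        refine le_trans ?_ (mul_le_mul_of_nonneg_left
          (lp.sum_rpow_le_norm_rpow (by norm_num) ψ s) (by positivity))
        rw [Finset.mul_sum]
        refine Finset.sum_le_sum fun x _ => ?_
        rw [← Real.mul_rpow (norm_nonneg _) (norm_nonneg _)]
        show ‖(V x : ℂ) * ψ x‖ ^ (2 : ℝ≥0∞).toReal ≤ _
        rw [norm_mul, Complex.norm_real]
        gcongr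
        exact lp.norm_apply_le_norm (by simp) V x)

/-- The discrete Schrödinger operator `H_V = Δ + V` on `ℓ²(ℤ²)`. -/
noncomputable def schrodinger (V : Potential) : Space →L[ℂ] Space :=
  laplacian + mulPotential V

theorem laplacian_apply (ψ : Space) (n m : ℤ) :
    laplacian ψ (n, m) = ψ (n - 1, m) + ψ (n + 1, m) + ψ (n, m - 1) + ψ (n, m + 1) := by
  show ψ (n + -1, m + 0) + ψ (n + 1, m + 0) + ψ (n + 0, m + -1) + ψ (n + 0, m + 1) = _
  simp only [add_zero, ← sub_eq_add_neg]

theorem schrodinger_apply (V : Potential) (ψ : Space) (n m : ℤ) :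
    schrodinger V ψ (n, m) = ψ (n - 1, m) + ψ (n + 1, m) + ψ (n, m - 1) + ψ (n, m + 1)
      + (V (n, m) : ℂ) * ψ (n, m) := by
  rw [← laplacian_apply]
  rfl

end LatticeSchrodinger

/-! Floquet theory replaces `H_V` by the self-adjoint pq × pq matrices `fiber θ v`. The spectrum is
the union of the ranges of their sorted eigenvalues `band θ v k` (`exists_band_eq_of_mem_spectrum`,
`band_mem_spectrum`). Each range is an interval, so a gap can only separate two consecutive bands.
By Weyl's inequality `V` moves every band by at most ‖V‖, so consecutive free bands that overlap in
positive length still meet for small ‖V‖ (`exists_overlap_margin`). What remains is to find the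
consecutive free bands that do not overlap in this sense (`IsTouching`).

The free eigenvalues are the values of 2 cos + 2 cos on a translate of the grid (2πℤ/p) × (2πℤ/q).
If E separates bands n and n + 1, then for every translate at most n + 1 grid points have value
above E, and at least n + 1 have value at or above E. Integrating this in y shows that ∑ⱼ arccos(E/2
− cos(x + 2πj/p)) is independent of x (`sum_arccos_eq_of_gridCount`). For 0 ≤ E < 4, however, a
summand opens up from zero at least linearly at the point where its section closes. Only a concave
corner of another summand at the same x could compensate, and one exists only if E = 0 and p is even
(`sum_arccos_sub_cos_not_const`). Negative E reduces to this by a half-period shift, and exchanging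
the axes makes q even too.

So touching forces E = 0 with p and q both even. The constant value of the sum then determines n, so
at most one pair touches. A gap opened between that pair stays within ‖V‖ of 0. -/

namespace LatticeSchrodinger

/-! ### Sorted eigenvalues of symmetric operators in finite dimension. -/

section SymmetricOperators

theorem norm_sq_eq_sum_repr {W ι : Type*} [NormedAddCommGroup W] [InnerProductSpace ℂ W]
    [Fintype ι] (b : OrthonormalBasis ι ℂ W) (u : W) : ‖u‖ ^ 2 = ∑ i, ‖b.repr u i‖ ^ 2 := by
  rw [← b.repr.norm_map u, EuclideanSpace.norm_sq_eq]

variable {W : Type*} [NormedAddCommGroup W] [InnerProductSpace ℂ W] [FiniteDimensional ℂ W]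
  {N : ℕ} {S T : W →ₗ[ℂ] W}

theorem inner_apply_self_eq_sum_eigenvalues (hT : T.IsSymmetric)
    (hN : Module.finrank ℂ W = N) (u : W) :
    RCLike.re (inner ℂ u (T u))
      = ∑ i, hT.eigenvalues hN i * ‖(hT.eigenvectorBasis hN).repr u i‖ ^ 2 := by
  rw [← (hT.eigenvectorBasis hN).repr.inner_map_map, PiLp.inner_apply, map_sum]
  refine Finset.sum_congr rfl fun i _ => ?_
  rw [hT.eigenvectorBasis_apply_self_apply hN u i, RCLike.inner_apply, mul_assoc,
    RCLike.mul_conj]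
  norm_cast

/-- An operator all of whose eigenvalues are `ε`-far from `E` is `ε`-bounded below off `E`. -/
theorem mul_norm_le_norm_apply_sub_smul (hT : T.IsSymmetric) (hN : Module.finrank ℂ W = N)
    {E ε : ℝ} (hε : 0 ≤ ε) (h : ∀ i, ε ≤ |hT.eigenvalues hN i - E|) (u : W) :
    ε * ‖u‖ ≤ ‖T u - (E : ℂ) • u‖ := by
  refine le_of_sq_le_sq ?_ (norm_nonneg _)
  rw [mul_pow, norm_sq_eq_sum_repr (hT.eigenvectorBasis hN),
    norm_sq_eq_sum_repr (hT.eigenvectorBasis hN), Finset.mul_sum]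
  refine Finset.sum_le_sum fun i _ => ?_
  have : (hT.eigenvectorBasis hN).repr (T u - (E : ℂ) • u) i
      = ((hT.eigenvalues hN i - E : ℝ) : ℂ) * (hT.eigenvectorBasis hN).repr u i := by
    rw [map_sub, map_smul, PiLp.sub_apply, PiLp.smul_apply,
      hT.eigenvectorBasis_apply_self_apply hN u i]
    rw [Complex.ofReal_sub, sub_mul]
    rfl
  rw [this, norm_mul, mul_pow, Complex.norm_real, Real.norm_eq_abs]
  gcongr
  exact h i

/-- **Weyl's inequality**: sorted eigenvalues are monotone in the quadratic form. -/
theorem eigenvalues_le_eigenvalues_add (hS : S.IsSymmetric) (hT : T.IsSymmetric)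
    (hN : Module.finrank ℂ W = N) {c : ℝ}
    (h : ∀ u, RCLike.re (inner ℂ u (T u)) ≤ RCLike.re (inner ℂ u (S u)) + c * ‖u‖ ^ 2)
    (k : Fin N) : hT.eigenvalues hN k ≤ hS.eigenvalues hN k + c := by
  classical
  set b := hT.eigenvectorBasis hN
  set a := hS.eigenvectorBasis hN
  -- Eigenvalues decrease with the index: `P` carries the top k + 1 of `T`, `Q` the bottom N − k of
  -- `S`. The dimensions add up to N + 1, so the two subspaces share a nonzero vector.
  set P := Submodule.span ℂ (Set.range fun i : Finset.Iic k => b i)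
  set Q := Submodule.span ℂ (Set.range fun i : Finset.Ici k => a i)
  have hP : Module.finrank ℂ P = k + 1 := by
    refine (finrank_span_eq_card
      (b.orthonormal.linearIndependent.comp _ Subtype.val_injective)).trans ?_
    rw [Fintype.card_coe, Fin.card_Iic]
  have hQ : Module.finrank ℂ Q = N - k := by
    refine (finrank_span_eq_card
      (a.orthonormal.linearIndependent.comp _ Subtype.val_injective)).trans ?_
    rw [Fintype.card_coe, Fin.card_Ici]
  have hPQ : P ⊓ Q ≠ ⊥ := by
    intro h0
    have h1 := Submodule.finrank_sup_add_finrank_inf_eq P Q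
    have h2 := Submodule.finrank_le (P ⊔ Q)
    rw [h0, finrank_bot, hP, hQ] at h1
    have := k.2
    omega
  obtain ⟨u, ⟨huP, huQ⟩, hu⟩ := (Submodule.ne_bot_iff _).1 hPQ
  have vanish : ∀ (d : OrthonormalBasis (Fin N) ℂ W) (s : Finset (Fin N)),
      u ∈ Submodule.span ℂ (Set.range fun i : s => d i) → ∀ i ∉ s, d.repr u i = 0 := by
    intro d s hs i hi
    rw [d.repr_apply_apply]
    refine Submodule.span_induction (p := fun w _ => inner ℂ (d i) w = 0) ?_ (by simp)
      (fun x y _ _ hx hy => by rw [inner_add_right, hx, hy, add_zero])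
      (fun r x _ hx => by rw [inner_smul_right, hx, mul_zero]) hs
    rintro _ ⟨j, rfl⟩
    refine d.orthonormal.inner_eq_zero fun hij => hi (hij ▸ j.2)
  have hpos : 0 < ‖u‖ ^ 2 := by positivity
  have h1 : hT.eigenvalues hN k * ‖u‖ ^ 2 ≤ RCLike.re (inner ℂ u (T u)) := by
    rw [inner_apply_self_eq_sum_eigenvalues hT hN, norm_sq_eq_sum_repr b, Finset.mul_sum]
    refine Finset.sum_le_sum fun i _ => ?_
    by_cases hi : i ≤ k
    · exact mul_le_mul_of_nonneg_right (hT.eigenvalues_antitone hN hi) (by positivity)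
    · have := vanish b (Finset.Iic k) huP i (by simpa using hi)
      simp [b, this]
  have h2 : RCLike.re (inner ℂ u (S u)) ≤ hS.eigenvalues hN k * ‖u‖ ^ 2 := by
    rw [inner_apply_self_eq_sum_eigenvalues hS hN, norm_sq_eq_sum_repr a, Finset.mul_sum]
    refine Finset.sum_le_sum fun i _ => ?_
    by_cases hi : k ≤ i
    · exact mul_le_mul_of_nonneg_right (hS.eigenvalues_antitone hN hi) (by positivity)
    · have := vanish a (Finset.Ici k) huQ i (by simpa using hi)
      simp [a, this]
  have h3 := h u
  refine le_of_mul_le_mul_right ?_ hpos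
  linarith

/-- A norm bound on `T - S` bounds the difference of the quadratic forms by Cauchy–Schwarz; Weyl's
inequality is then applied in both directions. -/
theorem abs_eigenvalues_sub_le (hS : S.IsSymmetric) (hT : T.IsSymmetric)
    (hN : Module.finrank ℂ W = N) {c : ℝ} (h : ∀ u, ‖T u - S u‖ ≤ c * ‖u‖) (k : Fin N) :
    |hT.eigenvalues hN k - hS.eigenvalues hN k| ≤ c := by
  have key : ∀ u, |RCLike.re (inner ℂ u (T u)) - RCLike.re (inner ℂ u (S u))| ≤ c * ‖u‖ ^ 2 := by
    intro u
    rw [← map_sub, ← inner_sub_right]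
    calc |RCLike.re (inner ℂ u (T u - S u))| ≤ ‖inner ℂ u (T u - S u)‖ := RCLike.abs_re_le_norm _
      _ ≤ ‖u‖ * ‖T u - S u‖ := norm_inner_le_norm _ _
      _ ≤ ‖u‖ * (c * ‖u‖) := by gcongr; exact h u
      _ = c * ‖u‖ ^ 2 := by ring
  rw [abs_sub_le_iff]
  constructor
  · have := eigenvalues_le_eigenvalues_add hS hT hN (c := c)
      (fun u => by linarith [(abs_le.1 (key u)).2]) k
    linarith
  · have := eigenvalues_le_eigenvalues_add hT hS hN (c := c)
      (fun u => by linarith [(abs_le.1 (key u)).1]) k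
    linarith

/-- The multiset of sorted eigenvalues is read off from any basis of eigenvectors. -/
theorem map_eigenvalues_eq_map_of_basis {ι : Type*} [Fintype ι] (hT : T.IsSymmetric)
    (hN : Module.finrank ℂ W = N) (b : Module.Basis ι ℂ W) (f : ι → ℝ)
    (hb : ∀ i, T (b i) = (f i : ℂ) • b i) :
    Finset.univ.val.map (hT.eigenvalues hN) = Finset.univ.val.map f := by
  classical
  have hmat : LinearMap.toMatrix b b T = Matrix.diagonal fun i => (f i : ℂ) := by
    ext i j
    rw [LinearMap.toMatrix_apply, hb, map_smul, b.repr_self, Matrix.diagonal_apply]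
    by_cases hij : i = j
    · subst hij; simp
    · simp [hij]
  have h1 : T.charpoly.roots = Finset.univ.val.map fun i => (f i : ℂ) := by
    rw [← LinearMap.charpoly_toMatrix T b, hmat, Matrix.charpoly_diagonal]
    rw [← Polynomial.roots_multiset_prod_X_sub_C (Finset.univ.val.map fun i => (f i : ℂ)),
      Multiset.map_map]
    rfl
  have h2 := hT.roots_charpoly_eq_eigenvalues hN
  rw [h1] at h2
  -- Both multisets of roots consist of real numbers cast to ℂ; taking real parts recovers the
  -- equality over ℝ.
  have h3 := congrArg (Multiset.map Complex.re) h2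
  simp only [Multiset.map_map] at h3
  simpa [Function.comp_def] using h3.symm

theorem card_filter_eigenvalues_of_basis {ι : Type*} [Fintype ι] (hT : T.IsSymmetric)
    (hN : Module.finrank ℂ W = N) (b : Module.Basis ι ℂ W) (f : ι → ℝ)
    (hb : ∀ i, T (b i) = (f i : ℂ) • b i) (P : ℝ → Prop) [DecidablePred P] :
    (Finset.univ.filter fun k => P (hT.eigenvalues hN k)).card
      = (Finset.univ.filter fun i => P (f i)).card := by
  have h := congrArg (Multiset.countP P) (map_eigenvalues_eq_map_of_basis hT hN b f hb)
  rwa [Multiset.countP_map, Multiset.countP_map] at h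

end SymmetricOperators

/-! ### Level sets of 2 cos + 2 cos and the total width of their sections. -/

section LevelSets

open Real Filter Topology MeasureTheory

/-- For 0 ≤ u ≤ 2, 1 − u ≤ 1 − u²/2 ≤ cos u. The true growth is of order √u, but a linear bound
suffices. -/
theorem self_le_arccos_one_sub {u : ℝ} (h0 : 0 ≤ u) (h2 : u ≤ 2) : u ≤ arccos (1 - u) := by
  have h : 1 - u ≤ cos u := by nlinarith [one_sub_sq_div_two_le_cos (x := u)]
  calc u = arccos (cos u) := (arccos_cos h0 (by linarith [pi_gt_three])).symm
    _ ≤ arccos (1 - u) := antitone_arccos h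

/-- A function differentiable at `x` has second differences `o(t)` there. -/
theorem eventually_neg_mul_le_second_difference {F : ℝ → ℝ} {x : ℝ} (hF : DifferentiableAt ℝ F x)
    {ε : ℝ} (hε : 0 < ε) :
    ∀ᶠ t in 𝓝[>] (0 : ℝ), -ε * t ≤ F (x - t) + F (x + t) - 2 * F x := by
  have h1 : HasDerivAt (fun t => F (x + t)) (deriv F x) 0 := by
    have : HasDerivAt F (deriv F x) (x + 0) := by simpa using hF.hasDerivAt
    simpa using this.comp_const_add x 0
  have h2 : HasDerivAt (fun t => F (x - t)) (-deriv F x) 0 := by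
    have : HasDerivAt F (deriv F x) (x - 0) := by simpa using hF.hasDerivAt
    simpa using this.comp_const_sub x 0
  have h3 := (h2.add h1).tendsto_slope_zero
  rw [neg_add_cancel] at h3
  have h4 := (h3.mono_left (nhdsWithin_mono 0 (fun t (ht : 0 < t) => ht.ne'))).eventually
    (lt_mem_nhds (show -ε < 0 by linarith))
  filter_upwards [h4, self_mem_nhdsWithin] with t ht ht0
  have ht0 : 0 < t := ht0
  simp only [Pi.add_apply, zero_add, sub_zero, add_zero, smul_eq_mul] at ht
  rw [inv_mul_eq_div, lt_div_iff₀ ht0] at ht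
  linarith

/-- The half-width `arccos (c - cos x)` of a section of the sublevel set opens at least linearly
at the tip `x = arccos (c - 1)`. -/
theorem exists_mul_le_arccos_sub_cos {c : ℝ} (h0 : 0 ≤ c) (h2 : c < 2) :
    ∃ κ > 0, ∀ᶠ t in 𝓝[>] (0 : ℝ), κ * t ≤ arccos (c - cos (arccos (c - 1) - t)) := by
  -- For c = 0 the tip is π, where the cosine has zero slope, but the half-width is exactly t. For c
  -- > 0 the slope sin x at the tip is positive, and half of it serves as κ.
  rcases h0.eq_or_lt with rfl | hc
  · refine ⟨1, one_pos, ?_⟩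
    have : ∀ᶠ t in 𝓝[>] (0 : ℝ), t < π :=
      mem_nhdsWithin_of_mem_nhds (gt_mem_nhds pi_pos)
    filter_upwards [this, self_mem_nhdsWithin] with t ht ht0
    have ht0 : 0 < t := ht0
    rw [zero_sub, zero_sub, arccos_neg_one, cos_pi_sub, neg_neg, arccos_cos ht0.le ht.le, one_mul]
  · set x := arccos (c - 1)
    have hx : cos x = c - 1 := cos_arccos (by linarith) (by linarith)
    have hs : 0 < sin x := by
      rw [sin_arccos]
      apply Real.sqrt_pos.2
      nlinarith
    refine ⟨sin x / 2, by positivity, ?_⟩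
    have hd : HasDerivAt (fun t => cos (x - t)) (sin x) 0 := by
      have : HasDerivAt cos (-sin x) (x - 0) := by simpa using hasDerivAt_cos x
      simpa using this.comp_const_sub x 0
    have h3 := hd.tendsto_slope_zero
    have h4 := (h3.mono_left (nhdsWithin_mono 0 (fun t (ht : 0 < t) => ht.ne'))).eventually
      (lt_mem_nhds (show sin x / 2 < sin x by linarith))
    filter_upwards [h4, self_mem_nhdsWithin] with t ht ht0
    have ht0 : 0 < t := ht0
    simp only [zero_add, sub_zero, smul_eq_mul] at ht
    rw [inv_mul_eq_div, lt_div_iff₀ ht0] at ht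
    have h5 : 0 ≤ cos (x - t) - cos x := by nlinarith
    have := self_le_arccos_one_sub h5 (by linarith [cos_le_one (x - t), neg_one_le_cos x])
    rw [show 1 - (cos (x - t) - cos x) = c - cos (x - t) by rw [hx]; ring] at this
    linarith

/-- The total width of `p` equally spaced sections of the sublevel set is not constant. -/
theorem sum_arccos_sub_cos_not_const {p : ℕ} (hp : 0 < p) {c : ℝ} (h0 : 0 ≤ c) (h2 : c < 2)
    (hodd : c = 0 → Odd p) (K : ℝ) :
    ¬ ∀ x, ∑ j : Fin p, arccos (c - cos (x + 2 * π * j / p)) = K := by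
  intro hK
  obtain ⟨κ, hκ, hmain⟩ := exists_mul_le_arccos_sub_cos h0 h2
  set x := arccos (c - 1)
  have hx : cos x = c - 1 := cos_arccos (by linarith) (by linarith)
  have hp' : (0 : ℝ) < p := by exact_mod_cast hp
  set F : ℝ → ℝ := fun y => arccos (c - cos y)
  set s : Fin p → ℝ := fun j => 2 * π * j / p
  set D : Fin p → ℝ → ℝ := fun j t => F (x + s j - t) + F (x + s j + t) - 2 * F (x + s j)
  have hF0 : ∀ y, 0 ≤ F y := fun y => arccos_nonneg _
  have hD : ∀ t, ∑ j, D j t = 0 := by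
    intro t
    have e : ∀ y, ∑ j, F (y + s j) = K := hK
    simp only [D, Finset.sum_sub_distrib, Finset.sum_add_distrib, ← Finset.mul_sum]
    have e1 : ∑ j, F (x + s j - t) = K := by
      rw [← e (x - t)]; exact Finset.sum_congr rfl fun j _ => by ring_nf
    have e2 : ∑ j, F (x + s j + t) = K := by
      rw [← e (x + t)]; exact Finset.sum_congr rfl fun j _ => by ring_nf
    rw [e1, e2, e x]; ring
  -- Each of the p summands may lose κt/(2p), in total κt/2, which is less than the gain κt of the
  -- summand j = 0.
  have hεpos : 0 < κ / (2 * p) := by positivity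
  have hlow : ∀ j, ∀ᶠ t in 𝓝[>] (0 : ℝ), -(κ / (2 * p)) * t ≤ D j t := by
    intro j
    -- Here the summand vanishes, hence is minimal, and its second difference is nonnegative.
    by_cases hj : cos (x + s j) = c - 1
    · filter_upwards [self_mem_nhdsWithin] with t ht
      have ht : 0 < t := ht
      have hz : F (x + s j) = 0 := by simp [F, hj]
      have h1 := hF0 (x + s j - t)
      have h2 := hF0 (x + s j + t)
      simp only [D, hz]
      nlinarith [mul_pos hεpos ht]
    · refine eventually_neg_mul_le_second_difference ?_ hεpos
      have hne1 : c - cos (x + s j) ≠ 1 := fun h => hj (by linarith)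
      -- A concave corner would need c = 0 and cos = 1. Then x = π, and π + 2πj/p ∈ 2πℤ contradicts
      -- p odd.
      have hne2 : c - cos (x + s j) ≠ -1 := by
        intro h
        have h3 := cos_le_one (x + s j)
        have hc : c = 0 := by linarith
        obtain ⟨m, hm⟩ := (cos_eq_one_iff (x + s j)).1 (by linarith)
        have hxpi : x = π := by simp [x, hc]
        rw [hxpi] at hm
        simp only [s] at hm
        have h4 : (m : ℝ) * 2 * p = p + 2 * j := by
          field_simp at hm
          nlinarith [pi_pos]
        have h5 : m * 2 * (p : ℤ) = p + 2 * (j : ℕ) := by exact_mod_cast h4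
        obtain ⟨r, hr⟩ := hodd hc
        have : (p : ℤ) = 2 * (m * p - (j : ℕ)) := by linarith
        omega
      exact (differentiableAt_arccos.2 ⟨hne2, hne1⟩).comp (x + s j)
        (f := fun y => c - cos y) ((differentiable_cos _).const_sub c)
  have h0 : ∀ᶠ t in 𝓝[>] (0 : ℝ), κ * t ≤ D ⟨0, hp⟩ t := by
    filter_upwards [hmain] with t ht
    have hs : s ⟨0, hp⟩ = 0 := by simp [s]
    have hz : F x = 0 := by simp [F, hx]
    simp only [D, hs, add_zero, hz]
    have := hF0 (x + t)
    have : κ * t ≤ F (x - t) := ht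
    linarith
  obtain ⟨t, ht1, ht2, ht⟩ := ((eventually_all.2 hlow).and (h0.and self_mem_nhdsWithin)).exists
  have ht : 0 < t := ht
  have h5 : ∑ j, (D j t + κ / (2 * p) * t) = p * (κ / (2 * p) * t) := by
    rw [Finset.sum_add_distrib, hD]; simp
  have h6 : D ⟨0, hp⟩ t + κ / (2 * p) * t ≤ ∑ j, (D j t + κ / (2 * p) * t) :=
    Finset.single_le_sum (f := fun j => D j t + κ / (2 * p) * t)
      (fun j _ => by linarith [ht1 j]) (Finset.mem_univ _)
  have h7 : (p : ℝ) * (κ / (2 * p) * t) = κ * t / 2 := by field_simp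
  have h8 : 0 < κ / (2 * p) * t := by positivity
  nlinarith [mul_pos hκ ht]

/-- The truth value of `P` at the threshold `s` affects only a null set, so strict and nonstrict
superlevel sets are handled together. -/
theorem integral_ite_cos {s : ℝ} {P : ℝ → Prop} [DecidablePred P] (hm : MeasurableSet {z | P z})
    (h1 : ∀ z, s < z → P z) (h2 : ∀ z, P z → s ≤ z) :
    ∫ y in (0 : ℝ)..2 * π, (if P (cos y) then (1 : ℝ) else 0) = 2 * arccos s := by
  have hper : Function.Periodic (fun y => if P (cos y) then (1 : ℝ) else 0) (2 * π) := by
    intro y; simp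
  -- On the window (−π, π] the set is |y| < arccos s up to endpoints.
  have := hper.intervalIntegral_add_eq 0 (-π)
  rw [zero_add, show -π + 2 * π = π by ring] at this
  rw [this, intervalIntegral.integral_of_le (by linarith [pi_pos])]
  have hA : MeasurableSet {y | P (cos y)} := measurable_cos hm
  have hind : (fun y => if P (cos y) then (1 : ℝ) else 0) = Set.indicator {y | P (cos y)} 1 := by
    ext y; simp [Set.indicator_apply]
  rw [hind, integral_indicator_one hA, measureReal_restrict_apply hA]
  have ha := arccos_nonneg s
  have hpi := arccos_le_pi s
  have hsub1 : Set.Ioo (-arccos s) (arccos s) ⊆ {y | P (cos y)} ∩ Set.Ioc (-π) π := by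
    rintro y ⟨hy1, hy2⟩
    have hy : |y| < arccos s := abs_lt.2 ⟨hy1, hy2⟩
    refine ⟨h1 _ ?_, by constructor <;> linarith⟩
    by_contra! hcon
    rw [← cos_abs] at hcon
    have := antitone_arccos hcon
    rw [arccos_cos (abs_nonneg y) (by linarith)] at this
    linarith
  have hsub2 : {y | P (cos y)} ∩ Set.Ioc (-π) π ⊆ Set.Icc (-arccos s) (arccos s) := by
    rintro y ⟨hy, hy1, hy2⟩
    have h3 := h2 _ hy
    rw [← cos_abs] at h3
    have := antitone_arccos h3
    rw [arccos_cos (abs_nonneg y) (abs_le.2 ⟨hy1.le, hy2⟩)] at this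
    exact abs_le.1 this
  apply le_antisymm
  · refine (measureReal_mono hsub2 (by simp)).trans ?_
    rw [Real.volume_real_Icc_of_le (by linarith)]; linarith
  · refine le_trans ?_ (measureReal_mono hsub1 ?_)
    · rw [Real.volume_real_Ioo_of_le (by linarith)]; linarith
    · exact ((measure_mono hsub2).trans_lt (by simp)).ne

/-- Integration over one cell of an equally spaced sum unfolds the sum. -/
theorem integral_sum_equally_spaced {q : ℕ} (hq : 0 < q) {h : ℝ → ℝ}
    (hint : ∀ a b, IntervalIntegrable h volume a b) :
    ∫ y in (0 : ℝ)..2 * π / q, ∑ l : Fin q, h (y + 2 * π * l / q) = ∫ y in (0 : ℝ)..2 * π, h y := by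
  have hq' : (q : ℝ) ≠ 0 := by positivity
  have hint' : ∀ l : Fin q, IntervalIntegrable (fun y => h (y + 2 * π * l / q)) volume 0
      (2 * π / q) := fun l => by
    simpa using (hint (0 + 2 * π * l / q) (2 * π / q + 2 * π * l / q)).comp_add_right
      (2 * π * l / q)
  rw [intervalIntegral.integral_finsetSum (fun l _ => hint' l)]
  simp only [intervalIntegral.integral_comp_add_right]
  have := intervalIntegral.sum_integral_adjacent_intervals (f := h) (μ := volume)
    (a := fun k : ℕ => 2 * π * k / q) (n := q) (fun k _ => hint _ _)
  rw [← Fin.sum_univ_eq_sum_range (fun k : ℕ =>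
    ∫ y in (2 * π * (k : ℕ) / q)..(2 * π * (k + 1 : ℕ) / q), h y)] at this
  rw [Nat.cast_zero, mul_zero, zero_div, mul_div_assoc, div_self hq', mul_one] at this
  rw [← this]
  refine Finset.sum_congr rfl fun l _ => ?_
  congr 1
  · ring
  · push_cast; ring

/-- The number of points of the grid `(x, y) + (2πℤ/p) × (2πℤ/q)` at which the symbol
`2 cos + 2 cos` satisfies `P`. -/
noncomputable def gridCount (p q : ℕ) (P : ℝ → Prop) (x y : ℝ) : ℕ :=
  open Classical in
  (Finset.univ.filter fun i : Fin p × Fin q =>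
    P (2 * cos (x + 2 * π * i.1 / p) + 2 * cos (y + 2 * π * i.2 / q))).card

theorem gridCount_swap (p q : ℕ) (P : ℝ → Prop) (x y : ℝ) :
    gridCount p q P x y = gridCount q p P y x := by
  classical
  refine Finset.card_equiv (Equiv.prodComm _ _) fun i => ?_
  simp [add_comm]

/-- For fixed x the q translates in y over one cell tile a full period, so each j contributes the
measure of one whole section. -/
theorem gridCount_integral {p q : ℕ} (hq : 0 < q) {E : ℝ} {P : ℝ → Prop}
    (hm : MeasurableSet {z | P z}) (h1 : ∀ z, E < z → P z) (h2 : ∀ z, P z → E ≤ z) (x : ℝ) :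
    IntervalIntegrable (fun y => (gridCount p q P x y : ℝ)) volume 0 (2 * π / q) ∧
    ∫ y in (0 : ℝ)..2 * π / q, (gridCount p q P x y : ℝ)
      = 2 * ∑ j : Fin p, arccos (E / 2 - cos (x + 2 * π * j / p)) := by
  classical
  set h : Fin p → ℝ → ℝ := fun j y =>
    if P (2 * cos (x + 2 * π * j / p) + 2 * cos y) then 1 else 0
  have hmeas : ∀ j, Measurable (h j) := fun j =>
    Measurable.ite (((measurable_const.mul measurable_cos).const_add _) hm)
      measurable_const measurable_const
  have hint : ∀ j a b, IntervalIntegrable (h j) volume a b := fun j a b => by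
    refine (intervalIntegrable_const (c := (1 : ℝ))).mono_fun (hmeas j).aestronglyMeasurable
      (Eventually.of_forall fun y => ?_)
    simp only [h]
    split_ifs <;> simp
  have hcount : ∀ y, (gridCount p q P x y : ℝ) = ∑ j, ∑ l : Fin q, h j (y + 2 * π * l / q) := by
    intro y
    rw [gridCount, Finset.card_filter, Nat.cast_sum, Fintype.sum_prod_type]
    simp [h]
  have hint' : ∀ j, ∀ l : Fin q, IntervalIntegrable (fun y => h j (y + 2 * π * l / q)) volume 0
      (2 * π / q) := fun j l => by
    simpa using (hint j (0 + 2 * π * l / q) (2 * π / q + 2 * π * l / q)).comp_add_right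
      (2 * π * l / q)
  have hint2 : ∀ j, IntervalIntegrable (fun y => ∑ l : Fin q, h j (y + 2 * π * l / q)) volume 0
      (2 * π / q) := fun j => by
    simpa only [Finset.sum_fn] using IntervalIntegrable.sum Finset.univ fun l _ => hint' j l
  simp only [hcount]
  refine ⟨by simpa only [Finset.sum_fn] using
    IntervalIntegrable.sum Finset.univ fun j _ => hint2 j, ?_⟩
  rw [intervalIntegral.integral_finsetSum (fun j _ => hint2 j), Finset.mul_sum]
  refine Finset.sum_congr rfl fun j _ => ?_
  rw [integral_sum_equally_spaced hq (hint j)]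
  set a := cos (x + 2 * π * j / p)
  exact integral_ite_cos (s := E / 2 - a) (P := fun z => P (2 * a + 2 * z))
    (((measurable_const.mul measurable_id).const_add _) hm)
    (fun z hz => h1 _ (by linarith)) (fun z hz => by linarith [h2 _ hz])

/-- If `K` separates the strict from the nonstrict grid counts at level `E`, then the sections of
the superlevel set have constant total width. -/
theorem sum_arccos_eq_of_gridCount {p q : ℕ} (hq : 0 < q) {E : ℝ} {K : ℕ}
    (h1 : ∀ x y, gridCount p q (E < ·) x y ≤ K) (h2 : ∀ x y, K ≤ gridCount p q (E ≤ ·) x y)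
    (x : ℝ) : ∑ j : Fin p, arccos (E / 2 - cos (x + 2 * π * j / p)) = π * K / q := by
  have hq' : (0 : ℝ) < q := by exact_mod_cast hq
  obtain ⟨i1, e1⟩ := gridCount_integral (p := p) hq (E := E) (P := (E < ·)) measurableSet_Ioi
    (fun _ h => h) (fun _ h => h.le) x
  obtain ⟨i2, e2⟩ := gridCount_integral (p := p) hq (E := E) (P := (E ≤ ·)) measurableSet_Ici
    (fun _ h => h.le) (fun _ h => h) x
  have hle : (0 : ℝ) ≤ 2 * π / q := by positivity
  have hc : ∫ y in (0 : ℝ)..2 * π / q, (K : ℝ) = 2 * (π * K / q) := by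
    simp; ring
  -- The strict and nonstrict counts have the same integral, and the constant `K` is squeezed
  -- between them.
  have u1 := intervalIntegral.integral_mono_on hle i1 intervalIntegrable_const
    (fun y _ => (Nat.cast_le (α := ℝ)).2 (h1 x y))
  have u2 := intervalIntegral.integral_mono_on hle intervalIntegrable_const i2
    (fun y _ => (Nat.cast_le (α := ℝ)).2 (h2 x y))
  rw [e1, hc] at u1
  rw [e2, hc] at u2
  linarith

/-- Both constants are read off from the same sum of widths, at x = 0. -/
theorem eq_of_gridCount {p q : ℕ} (hq : 0 < q) {E : ℝ} {K K' : ℕ}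
    (h1 : ∀ x y, gridCount p q (E < ·) x y ≤ K) (h2 : ∀ x y, K ≤ gridCount p q (E ≤ ·) x y)
    (h1' : ∀ x y, gridCount p q (E < ·) x y ≤ K') (h2' : ∀ x y, K' ≤ gridCount p q (E ≤ ·) x y) :
    K = K' := by
  have hq' : (0 : ℝ) < q := by exact_mod_cast hq
  have := (sum_arccos_eq_of_gridCount hq h1 h2 0).symm.trans
    (sum_arccos_eq_of_gridCount hq h1' h2' 0)
  field_simp at this
  exact_mod_cast this

/-- The bounds 0 < K < pq exclude sections that are all empty or all full, which leaves |E| < 4;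
there, constancy of the width is possible only in the exceptional case. -/
theorem energy_eq_zero_and_even_left_of_gridCount {p q : ℕ} (hp : 0 < p) (hq : 0 < q) {E : ℝ}
    {K : ℕ} (hK0 : 0 < K) (hK : K < p * q)
    (h1 : ∀ x y, gridCount p q (E < ·) x y ≤ K) (h2 : ∀ x y, K ≤ gridCount p q (E ≤ ·) x y) :
    E = 0 ∧ Even p := by
  have hsum := sum_arccos_eq_of_gridCount hq h1 h2
  have hq' : (0 : ℝ) < q := by exact_mod_cast hq
  have hK0' : (0 : ℝ) < K := by exact_mod_cast hK0
  have hlt : E < 4 := by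
    by_contra! hE
    have h := hsum 0
    rw [Finset.sum_eq_zero fun j _ => arccos_of_one_le
      (by linarith [cos_le_one (0 + 2 * π * (j : Fin p) / p)])] at h
    have : 0 < π * K / q := by positivity
    linarith
  have hgt : -4 < E := by
    by_contra! hE
    have h := hsum 0
    rw [Finset.sum_congr rfl fun j _ => arccos_of_le_neg_one
      (by linarith [neg_one_le_cos (0 + 2 * π * (j : Fin p) / p)])] at h
    simp only [Finset.sum_const, Finset.card_univ, Fintype.card_fin, nsmul_eq_mul] at h
    have hpi := pi_pos
    rw [eq_div_iff hq'.ne'] at h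
    have h3 : (p : ℝ) * q = K := by
      apply mul_left_cancel₀ hpi.ne'
      linarith
    have h4 : p * q = K := by exact_mod_cast h3
    omega
  rcases lt_or_ge E 0 with hneg | hnn
  · exfalso
    -- Shifting x by π negates the cosine and replaces each arccos by its complement to π, which
    -- reduces negative energies to positive ones.
    refine sum_arccos_sub_cos_not_const hp (c := -E / 2) (by linarith) (by linarith)
      (fun h => by linarith) (p * π - π * K / q) fun x => ?_
    rw [← hsum (x + π)]
    have : ∀ j : Fin p, arccos (E / 2 - cos (x + π + 2 * π * j / p))
        = π - arccos (-E / 2 - cos (x + 2 * π * j / p)) := by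
      intro j
      rw [← arccos_neg, show x + π + 2 * π * j / p = x + 2 * π * j / p + π by ring, cos_add_pi]
      ring_nf
    simp [this]
  · have hnot : ¬ (E / 2 = 0 → Odd p) := fun h =>
      sum_arccos_sub_cos_not_const hp (c := E / 2) (by linarith) (by linarith) h _ hsum
    rw [Classical.not_imp, Nat.not_odd_iff_even] at hnot
    exact ⟨by linarith [hnot.1], hnot.2⟩

theorem energy_eq_zero_and_even_of_gridCount {p q : ℕ} (hp : 0 < p) (hq : 0 < q) {E : ℝ}
    {K : ℕ} (hK0 : 0 < K) (hK : K < p * q)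
    (h1 : ∀ x y, gridCount p q (E < ·) x y ≤ K) (h2 : ∀ x y, K ≤ gridCount p q (E ≤ ·) x y) :
    E = 0 ∧ Even p ∧ Even q := by
  obtain ⟨hE, hpe⟩ := energy_eq_zero_and_even_left_of_gridCount hp hq hK0 hK h1 h2
  refine ⟨hE, hpe, (energy_eq_zero_and_even_left_of_gridCount hq hp (E := E) hK0
    (by rwa [mul_comm]) (fun x y => ?_) (fun x y => ?_)).2⟩
  · rw [gridCount_swap]; exact h1 y x
  · rw [gridCount_swap]; exact h2 y x

end LevelSets

/-! ### Floquet fibers, their bands, and diagonalization of the free fiber. -/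

section Fibers

open Complex

variable {p q : ℕ}

/-- Functions on one period cell. -/
abbrev Fiber (p q : ℕ) : Type := EuclideanSpace ℂ (ZMod p × ZMod q)

/-- Multiplication by a real function on the period cell. -/
noncomputable def cellMul (v : ZMod p × ZMod q → ℝ) : Fiber p q →ₗ[ℂ] Fiber p q where
  toFun u := WithLp.toLp 2 fun r => (v r : ℂ) * u r
  map_add' u w := by ext r; simp [mul_add]
  map_smul' c u := by ext r; simp [mul_left_comm]

theorem cellMul_apply (v : ZMod p × ZMod q → ℝ) (u : Fiber p q) (r : ZMod p × ZMod q) :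
    cellMul v u r = v r * u r := rfl

variable [NeZero p] [NeZero q]

/-- The translation `u ↦ (r ↦ u (r + k))` on the period cell. -/
noncomputable def cellShift (k : ZMod p × ZMod q) : Fiber p q ≃ₗᵢ[ℂ] Fiber p q :=
  LinearIsometryEquiv.piLpCongrLeft 2 ℂ ℂ (Equiv.addRight k).symm

theorem cellShift_apply (k : ZMod p × ZMod q) (u : Fiber p q) (r : ZMod p × ZMod q) :
    cellShift k u r = u (r + k) := rfl

/-- The Floquet fiber at quasimomentum `θ` of the Schrödinger operator with potential `v`. -/
noncomputable def fiber (θ : ℝ × ℝ) (v : ZMod p × ZMod q → ℝ) : Fiber p q →ₗ[ℂ] Fiber p q :=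
  exp (θ.1 * I) • (cellShift (1, 0)).toLinearEquiv.toLinearMap
  + exp (-(θ.1 * I)) • (cellShift (-1, 0)).toLinearEquiv.toLinearMap
  + exp (θ.2 * I) • (cellShift (0, 1)).toLinearEquiv.toLinearMap
  + exp (-(θ.2 * I)) • (cellShift (0, -1)).toLinearEquiv.toLinearMap + cellMul v

theorem fiber_def (θ : ℝ × ℝ) (v : ZMod p × ZMod q → ℝ) (u : Fiber p q) :
    fiber θ v u = exp (θ.1 * I) • cellShift (1, 0) u + exp (-(θ.1 * I)) • cellShift (-1, 0) u
      + exp (θ.2 * I) • cellShift (0, 1) u + exp (-(θ.2 * I)) • cellShift (0, -1) u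
      + cellMul v u := rfl

theorem fiber_apply (θ : ℝ × ℝ) (v : ZMod p × ZMod q → ℝ) (u : Fiber p q)
    (r : ZMod p × ZMod q) :
    fiber θ v u r = exp (θ.1 * I) * u (r + (1, 0)) + exp (-(θ.1 * I)) * u (r + (-1, 0))
      + exp (θ.2 * I) * u (r + (0, 1)) + exp (-(θ.2 * I)) * u (r + (0, -1)) + v r * u r := rfl

theorem inner_cellShift (k : ZMod p × ZMod q) (u w : Fiber p q) :
    inner ℂ (cellShift k u) w = inner ℂ u (cellShift (-k) w) := by
  rw [← (cellShift k).inner_map_map u (cellShift (-k) w)]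
  congr 1
  ext r
  simp [cellShift_apply]

theorem inner_cellMul (v : ZMod p × ZMod q → ℝ) (u w : Fiber p q) :
    inner ℂ (cellMul v u) w = inner ℂ u (cellMul v w) := by
  simp only [PiLp.inner_apply, cellMul_apply]
  refine Finset.sum_congr rfl fun r _ => ?_
  simp only [RCLike.inner_apply, map_mul, conj_ofReal]
  ring

theorem fiber_isSymmetric (θ : ℝ × ℝ) (v : ZMod p × ZMod q → ℝ) :
    (fiber θ v).IsSymmetric := by
  intro u w
  have hconj : ∀ t : ℝ, (starRingEnd ℂ) (exp (t * I)) = exp (-(t * I)) := fun t => by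
    rw [← exp_conj]; simp
  have hconj' : ∀ t : ℝ, (starRingEnd ℂ) (exp (-(t * I))) = exp (t * I) := fun t => by
    rw [← exp_conj]; simp
  simp only [fiber_def, inner_add_left, inner_add_right, inner_smul_left, inner_smul_right,
    inner_cellShift, inner_cellMul, hconj, hconj', Prod.neg_mk, neg_zero, neg_neg]
  ring

theorem norm_cellMul_le {v : ZMod p × ZMod q → ℝ} {c : ℝ} (hc : 0 ≤ c) (hv : ∀ r, |v r| ≤ c)
    (u : Fiber p q) : ‖cellMul v u‖ ≤ c * ‖u‖ := by
  refine le_of_sq_le_sq ?_ (by positivity)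
  rw [mul_pow, EuclideanSpace.norm_sq_eq, EuclideanSpace.norm_sq_eq, Finset.mul_sum]
  refine Finset.sum_le_sum fun r _ => ?_
  rw [cellMul_apply, norm_mul, mul_pow, norm_real, Real.norm_eq_abs]
  gcongr
  exact hv r

theorem finrank_fiber : Module.finrank ℂ (Fiber p q) = p * q := by
  simp [Fiber, ZMod.card]

/-- The band functions: eigenvalues of the fibers, in decreasing order. -/
noncomputable def band (θ : ℝ × ℝ) (v : ZMod p × ZMod q → ℝ) (k : Fin (p * q)) : ℝ :=
  (fiber_isSymmetric θ v).eigenvalues finrank_fiber k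

theorem band_antitone (θ : ℝ × ℝ) (v : ZMod p × ZMod q → ℝ) : Antitone (band θ v) :=
  (fiber_isSymmetric θ v).eigenvalues_antitone finrank_fiber

theorem abs_band_sub_band_le (θ : ℝ × ℝ) {v w : ZMod p × ZMod q → ℝ} {c : ℝ} (hc : 0 ≤ c)
    (h : ∀ r, |v r - w r| ≤ c) (k : Fin (p * q)) : |band θ v k - band θ w k| ≤ c := by
  refine abs_eigenvalues_sub_le _ _ _ (fun u => ?_) k
  have : fiber θ v u - fiber θ w u = cellMul (fun r => v r - w r) u := by
    ext r
    simp only [PiLp.sub_apply, fiber_apply, cellMul_apply]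
    push_cast
    ring
  rw [this]
  exact norm_cellMul_le hc h u

theorem abs_band_sub_band_le_of_quasimomentum (θ η : ℝ × ℝ) (v : ZMod p × ZMod q → ℝ)
    (k : Fin (p * q)) :
    |band θ v k - band η v k| ≤ ‖exp (θ.1 * I) - exp (η.1 * I)‖
      + ‖exp (-(θ.1 * I)) - exp (-(η.1 * I))‖ + ‖exp (θ.2 * I) - exp (η.2 * I)‖
      + ‖exp (-(θ.2 * I)) - exp (-(η.2 * I))‖ := by
  refine abs_eigenvalues_sub_le _ _ _ (fun u => ?_) k
  have : fiber θ v u - fiber η v u = (exp (θ.1 * I) - exp (η.1 * I)) • cellShift (1, 0) u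
      + (exp (-(θ.1 * I)) - exp (-(η.1 * I))) • cellShift (-1, 0) u
      + (exp (θ.2 * I) - exp (η.2 * I)) • cellShift (0, 1) u
      + (exp (-(θ.2 * I)) - exp (-(η.2 * I))) • cellShift (0, -1) u := by
    simp only [fiber_def, sub_smul]
    abel
  rw [this]
  refine (norm_add_le _ _).trans ?_
  rw [add_mul]
  refine add_le_add ((norm_add_le _ _).trans ?_) (by rw [norm_smul, LinearIsometryEquiv.norm_map])
  rw [add_mul]
  refine add_le_add ((norm_add_le _ _).trans ?_) (by rw [norm_smul, LinearIsometryEquiv.norm_map])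
  rw [add_mul, norm_smul, norm_smul, LinearIsometryEquiv.norm_map, LinearIsometryEquiv.norm_map]

/-- Sorted eigenvalues inherit continuity from the matrix through Weyl's inequality, even where they
cross. -/
theorem continuous_band (v : ZMod p × ZMod q → ℝ) (k : Fin (p * q)) :
    Continuous fun θ => band θ v k := by
  rw [continuous_iff_continuousAt]
  intro η
  refine tendsto_iff_norm_sub_tendsto_zero.2 ?_
  refine squeeze_zero (fun _ => norm_nonneg _)
    (fun θ => abs_band_sub_band_le_of_quasimomentum θ η v k) ?_
  have : Continuous fun θ : ℝ × ℝ => ‖exp (θ.1 * I) - exp (η.1 * I)‖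
      + ‖exp (-(θ.1 * I)) - exp (-(η.1 * I))‖ + ‖exp (θ.2 * I) - exp (η.2 * I)‖
      + ‖exp (-(θ.2 * I)) - exp (-(η.2 * I))‖ := by fun_prop
  simpa using this.tendsto η

/-- The characters of the period cell, indexed by residues. -/
noncomputable def cellChar (i : Fin p × Fin q) : AddChar (ZMod p × ZMod q) ℂ :=
  ((AddChar.mulShift ZMod.stdAddChar ((i.1 : ℕ) : ZMod p)).compAddMonoidHom
    (AddMonoidHom.fst _ _))
  * ((AddChar.mulShift ZMod.stdAddChar ((i.2 : ℕ) : ZMod q)).compAddMonoidHom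
    (AddMonoidHom.snd _ _))

theorem cellChar_apply (i : Fin p × Fin q) (r : ZMod p × ZMod q) :
    cellChar i r = ZMod.stdAddChar (((i.1 : ℕ) : ZMod p) * r.1)
      * ZMod.stdAddChar (((i.2 : ℕ) : ZMod q) * r.2) := rfl

/-- Distinct characters are linearly independent, so the pq characters obtained this way form a
basis. -/
theorem cellChar_injective : Function.Injective (cellChar (p := p) (q := q)) := by
  intro i j hij
  have h1 := DFunLike.congr_fun hij (1, 0)
  have h2 := DFunLike.congr_fun hij (0, 1)
  simp only [cellChar_apply, mul_one, mul_zero, AddChar.map_zero_eq_one, one_mul] at h1 h2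
  have e1 := congrArg ZMod.val (ZMod.injective_stdAddChar h1)
  have e2 := congrArg ZMod.val (ZMod.injective_stdAddChar h2)
  rw [ZMod.val_cast_of_lt i.1.2, ZMod.val_cast_of_lt j.1.2] at e1
  rw [ZMod.val_cast_of_lt i.2.2, ZMod.val_cast_of_lt j.2.2] at e2
  exact Prod.ext (Fin.ext e1) (Fin.ext e2)

/-- The basis of plane waves on the period cell. -/
noncomputable def planeWaveBasis : Module.Basis (Fin p × Fin q) ℂ (Fiber p q) :=
  haveI : Nonempty (Fin p × Fin q) :=
    ⟨(⟨0, Nat.pos_of_ne_zero (NeZero.ne p)⟩, ⟨0, Nat.pos_of_ne_zero (NeZero.ne q)⟩)⟩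
  (basisOfLinearIndependentOfCardEqFinrank
    ((AddChar.linearIndependent (ZMod p × ZMod q) ℂ).comp _ cellChar_injective)
    (by simp [ZMod.card])).map (WithLp.linearEquiv 2 ℂ (ZMod p × ZMod q → ℂ)).symm

theorem planeWaveBasis_apply (i : Fin p × Fin q) (r : ZMod p × ZMod q) :
    planeWaveBasis i r = cellChar i r := by
  simp [planeWaveBasis]

theorem cellChar_one_zero (i : Fin p × Fin q) :
    cellChar i (1, 0) = exp ((2 * Real.pi * i.1 / p : ℝ) * I) := by
  have := ZMod.stdAddChar_coe (N := p) (i.1 : ℕ)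
  rw [cellChar_apply]
  simp only [mul_one, mul_zero, AddChar.map_zero_eq_one]
  push_cast at this ⊢
  rw [this]
  ring_nf

theorem cellChar_zero_one (i : Fin p × Fin q) :
    cellChar i (0, 1) = exp ((2 * Real.pi * i.2 / q : ℝ) * I) := by
  have := ZMod.stdAddChar_coe (N := q) (i.2 : ℕ)
  rw [cellChar_apply]
  simp only [mul_one, mul_zero, AddChar.map_zero_eq_one, one_mul]
  push_cast at this ⊢
  rw [this]
  ring_nf

theorem fiber_planeWaveBasis (θ : ℝ × ℝ) (i : Fin p × Fin q) :
    fiber θ 0 (planeWaveBasis i)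
      = ((2 * Real.cos (θ.1 + 2 * Real.pi * i.1 / p)
        + 2 * Real.cos (θ.2 + 2 * Real.pi * i.2 / q) : ℝ) : ℂ) • planeWaveBasis i := by
  ext r
  have n1 : ((-1, 0) : ZMod p × ZMod q) = -(1, 0) := by simp
  have n2 : ((0, -1) : ZMod p × ZMod q) = -(0, 1) := by simp
  simp only [fiber_apply, PiLp.smul_apply, planeWaveBasis_apply, AddChar.map_add_eq_mul, n1, n2,
    AddChar.map_neg_eq_inv, cellChar_one_zero, cellChar_zero_one, ← exp_neg, Pi.zero_apply,
    smul_eq_mul]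
  push_cast
  rw [Complex.cos, Complex.cos]
  simp only [add_mul, neg_mul, neg_add, exp_add]
  ring

/-- The link between the ordered bands and the unordered values of the symbol on the grid. -/
theorem card_filter_band_zero (θ : ℝ × ℝ) (P : ℝ → Prop) [DecidablePred P] :
    (Finset.univ.filter fun k => P (band (p := p) (q := q) θ 0 k)).card
      = gridCount p q P θ.1 θ.2 := by
  rw [gridCount]
  convert card_filter_eigenvalues_of_basis (fiber_isSymmetric (p := p) (q := q) θ 0) finrank_fiber
    planeWaveBasis _ (fiber_planeWaveBasis θ) P
  rfl

end Fibers

/-! ### Self-adjointness and lower bounds off the spectrum. -/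

section Spectrum

theorem shift_apply (k x : ℤ × ℤ) (ψ : Space) : shift k ψ x = ψ (x + k) := rfl

theorem mulPotential_apply (V : Potential) (ψ : Space) (x : ℤ × ℤ) :
    mulPotential V ψ x = V x * ψ x := rfl

theorem inner_shift (k : ℤ × ℤ) (ψ φ : Space) :
    inner ℂ (shift k ψ) φ = inner ℂ ψ (shift (-k) φ) := by
  rw [lp.inner_eq_tsum, lp.inner_eq_tsum,
    ← (Equiv.addRight k).tsum_eq fun x => inner ℂ (ψ x) (shift (-k) φ x)]
  refine tsum_congr fun x => ?_
  simp [shift_apply]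

theorem inner_mulPotential (V : Potential) (ψ φ : Space) :
    inner ℂ (mulPotential V ψ) φ = inner ℂ ψ (mulPotential V φ) := by
  rw [lp.inner_eq_tsum, lp.inner_eq_tsum]
  refine tsum_congr fun x => ?_
  simp only [mulPotential_apply, RCLike.inner_apply, map_mul, Complex.conj_ofReal]
  ring

theorem schrodinger_isSelfAdjoint (V : Potential) : IsSelfAdjoint (schrodinger V) := by
  rw [ContinuousLinearMap.isSelfAdjoint_iff_isSymmetric]
  intro ψ φ
  change inner ℂ (schrodinger V ψ) φ = inner ℂ ψ (schrodinger V φ)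
  simp only [schrodinger, laplacian, add_apply, inner_add_left,
    inner_add_right, inner_shift, inner_mulPotential, Prod.neg_mk, neg_neg, neg_zero]
  ring

theorem norm_sq_hasSum (ψ : Space) : HasSum (fun x => ‖ψ x‖ ^ 2) (‖ψ‖ ^ 2) := by
  have := lp.hasSum_norm (p := 2) (by norm_num) ψ
  simpa using this

theorem norm_shift_le (k : ℤ × ℤ) (ψ : Space) : ‖shift k ψ‖ ≤ ‖ψ‖ := by
  have := (shift k).le_of_opNorm_le (LinearMap.mkContinuous_norm_le _ zero_le_one _) ψ
  simpa using this

/-- A self-adjoint operator bounded below off `E` has `E` in its resolvent set. -/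
theorem notMem_spectrum_of_bounded_below {X : Type*} [NormedAddCommGroup X]
    [InnerProductSpace ℂ X] [CompleteSpace X] {T : X →L[ℂ] X} (hT : IsSelfAdjoint T) {E ε : ℝ}
    (hε : 0 < ε) (h : ∀ ψ, ε * ‖ψ‖ ≤ ‖T ψ - (E : ℂ) • ψ‖) : (E : ℂ) ∉ spectrum ℂ T := by
  rw [spectrum.notMem_iff, ← IsUnit.neg_iff, neg_sub]
  set S := T - algebraMap ℂ (X →L[ℂ] X) E
  have hS : ∀ ψ, S ψ = T ψ - (E : ℂ) • ψ := fun ψ => by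
    simp [S, Algebra.algebraMap_eq_smul_one]
  have hSA : IsSelfAdjoint S := by
    refine hT.sub ?_
    rw [IsSelfAdjoint, ← algebraMap_star_comm]
    simp
  rw [ContinuousLinearMap.isUnit_iff_bijective,
    ContinuousLinearMap.bijective_iff_dense_range_and_antilipschitz]
  refine ⟨?_, ⟨ε, hε.le⟩⁻¹, ?_⟩
  -- The orthogonal complement of the range is the kernel of the adjoint, here `S` itself, and the
  -- lower bound makes it trivial.
  · rw [Submodule.topologicalClosure_eq_top_iff]
    have h1 := ContinuousLinearMap.orthogonal_range S
    rw [hSA.adjoint_eq] at h1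
    rw [eq_bot_iff]
    intro ψ hψ
    have h2 : ψ ∈ S.ker := h1 ▸ hψ
    have h3 : S ψ = 0 := h2
    have h4 := h ψ
    rw [← hS, h3, norm_zero] at h4
    have : ‖ψ‖ ≤ 0 := by nlinarith
    simpa using this
  · refine ContinuousLinearMap.antilipschitz_of_bound S fun ψ => ?_
    have := h ψ
    rw [← hS] at this
    change ‖ψ‖ ≤ ε⁻¹ * ‖S ψ‖
    rw [inv_mul_eq_div, le_div_iff₀ hε]
    linarith

theorem exists_bounded_below_of_notMem_spectrum {X : Type*} [NormedAddCommGroup X]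
    [NormedSpace ℂ X] {T : X →L[ℂ] X} {z : ℂ} (h : z ∉ spectrum ℂ T) :
    ∃ C : ℝ, 0 ≤ C ∧ ∀ ψ, ‖ψ‖ ≤ C * ‖T ψ - z • ψ‖ := by
  rw [spectrum.notMem_iff, ← IsUnit.neg_iff, neg_sub] at h
  obtain ⟨R, hR⟩ := h.exists_left_inv
  refine ⟨‖R‖, norm_nonneg _, fun ψ => ?_⟩
  have h1 := R.le_opNorm (T ψ - z • ψ)
  have h2 : R (T ψ - z • ψ) = ψ := by
    have := DFunLike.congr_fun hR ψ
    simpa [Algebra.algebraMap_eq_smul_one] using this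
  rwa [h2] at h1

end Spectrum

/-! ### The Bloch transform on finitely supported functions. -/

section Floquet

open Complex

variable {p q : ℕ}

/-- The class of a lattice point in the period cell. -/
def cellClass (p q : ℕ) : ℤ × ℤ →+ ZMod p × ZMod q :=
  (Int.castAddHom (ZMod p)).prodMap (Int.castAddHom (ZMod q))

theorem cellClass_apply (x : ℤ × ℤ) : cellClass p q x = ((x.1 : ZMod p), (x.2 : ZMod q)) := rfl

theorem IsPeriodic.apply_emod {V : ℤ × ℤ → ℝ} (hV : IsPeriodic p q V) (x : ℤ × ℤ) :
    V x = V (x.1 % p, x.2 % q) := by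
  obtain ⟨n, m⟩ := x
  have h1 : Function.Periodic (fun n : ℤ => V (n, m)) (p : ℤ) := fun n => (hV n m).1
  have h2 : Function.Periodic (fun m : ℤ => V (n % p, m)) (q : ℤ) := fun m => (hV _ m).2
  have e1 := h1.int_mul (n / p) (n % p)
  have e2 := h2.int_mul (m / q) (m % q)
  simp only [Int.cast_id] at e1 e2
  rw [mul_comm, Int.emod_add_mul_ediv] at e1 e2
  exact e1.trans e2

variable [NeZero p] [NeZero q]

/-- A periodic potential factors through the period cell. -/
theorem IsPeriodic.exists_cell {V : ℤ × ℤ → ℝ} (hV : IsPeriodic p q V) :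
    ∃ v : ZMod p × ZMod q → ℝ, (∀ x, V x = v (cellClass p q x)) ∧ ∀ r, ∃ x, v r = V x := by
  refine ⟨fun r => V (r.1.val, r.2.val), fun x => ?_, fun r => ⟨_, rfl⟩⟩
  rw [hV.apply_emod x, cellClass_apply]
  simp only [ZMod.val_intCast]

/-- The plane wave `e^{i⟨θ, x⟩}`. -/
noncomputable def planeWave (θ : ℝ × ℝ) (x : ℤ × ℤ) : ℂ := exp ((θ.1 * x.1 + θ.2 * x.2) * I)

theorem planeWave_add (θ : ℝ × ℝ) (x y : ℤ × ℤ) :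
    planeWave θ (x + y) = planeWave θ x * planeWave θ y := by
  rw [planeWave, planeWave, planeWave, ← exp_add]
  congr 1
  simp only [Prod.fst_add, Prod.snd_add]
  push_cast
  ring

theorem norm_planeWave (θ : ℝ × ℝ) (x : ℤ × ℤ) : ‖planeWave θ x‖ = 1 := by
  have := norm_exp_ofReal_mul_I (θ.1 * x.1 + θ.2 * x.2)
  push_cast at this
  exact this

/-- The Schrödinger operator on finitely supported functions. -/
noncomputable def finSchrodinger (V : ℤ × ℤ → ℝ) :
    (ℤ × ℤ →₀ ℂ) →ₗ[ℂ] (ℤ × ℤ →₀ ℂ) :=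
  Finsupp.lsum ℂ fun x => LinearMap.toSpanSingleton ℂ _
    (Finsupp.single (x + (1, 0)) 1 + Finsupp.single (x + (-1, 0)) 1
      + Finsupp.single (x + (0, 1)) 1 + Finsupp.single (x + (0, -1)) 1
      + Finsupp.single x (V x : ℂ))

/-- The embedding of finitely supported functions into `ℓ²`. -/
noncomputable def finToSpace : (ℤ × ℤ →₀ ℂ) →ₗ[ℂ] Space :=
  Finsupp.lsum ℂ fun x => LinearMap.toSpanSingleton ℂ _ (lp.single 2 x (1 : ℂ))

/-- The Bloch transform at quasimomentum `θ`. -/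
noncomputable def bloch (p q : ℕ) [NeZero p] [NeZero q] (θ : ℝ × ℝ) :
    (ℤ × ℤ →₀ ℂ) →ₗ[ℂ] Fiber p q :=
  Finsupp.lsum ℂ fun x => LinearMap.toSpanSingleton ℂ _
    (planeWave θ (-x) • EuclideanSpace.single (cellClass p q x) (1 : ℂ))

theorem finToSpace_apply (ψ : ℤ × ℤ →₀ ℂ) (x : ℤ × ℤ) : finToSpace ψ x = ψ x := by
  induction ψ using Finsupp.induction_linear with
  | zero => simp
  | add f g hf hg => simp [hf, hg]
  | single y c =>
    simp only [finToSpace, Finsupp.lsum_single, LinearMap.toSpanSingleton_apply,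
      lp.coeFn_smul, Pi.smul_apply, lp.coeFn_single, Finsupp.single_apply, smul_eq_mul]
    by_cases h : x = y
    · subst h; simp
    · simp [h, Ne.symm h]

theorem finSchrodinger_single (V : ℤ × ℤ → ℝ) (x : ℤ × ℤ) :
    finSchrodinger V (Finsupp.single x 1)
      = Finsupp.single (x + (1, 0)) 1 + Finsupp.single (x + (-1, 0)) 1
      + Finsupp.single (x + (0, 1)) 1 + Finsupp.single (x + (0, -1)) 1
      + Finsupp.single x (V x : ℂ) := by
  simp [finSchrodinger]

theorem bloch_single (θ : ℝ × ℝ) (x : ℤ × ℤ) (c : ℂ) :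
    bloch p q θ (Finsupp.single x c)
      = c • planeWave θ (-x) • EuclideanSpace.single (cellClass p q x) (1 : ℂ) := by
  simp [bloch]

theorem schrodinger_finToSpace (V : Potential) (ψ : ℤ × ℤ →₀ ℂ) :
    schrodinger V (finToSpace ψ) = finToSpace (finSchrodinger V ψ) := by
  have : (schrodinger V).toLinearMap ∘ₗ finToSpace = finToSpace ∘ₗ finSchrodinger V := by
    refine Finsupp.lhom_ext' fun x => LinearMap.ext_ring ?_
    simp only [LinearMap.comp_apply, Finsupp.lsingle_apply, finSchrodinger_single]
    refine lp.ext (funext fun y => ?_)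
    obtain ⟨n, m⟩ := y
    obtain ⟨a, b⟩ := x
    change schrodinger V _ (n, m) = _
    rw [schrodinger_apply]
    simp only [finToSpace_apply, Finsupp.add_apply, Finsupp.single_apply, Prod.mk_add_mk,
      Prod.mk.injEq, add_zero]
    have e1 : (a = n - 1 ∧ b = m) ↔ (a + 1 = n ∧ b = m) := by omega
    have e2 : (a = n + 1 ∧ b = m) ↔ (a + -1 = n ∧ b = m) := by omega
    have e3 : (a = n ∧ b = m - 1) ↔ (a = n ∧ b + 1 = m) := by omega
    have e4 : (a = n ∧ b = m + 1) ↔ (a = n ∧ b + -1 = m) := by omega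
    simp only [e1, e2, e3, e4]
    by_cases h : a = n ∧ b = m
    · obtain ⟨rfl, rfl⟩ := h; simp
    · simp [h]
  exact DFunLike.congr_fun this ψ

theorem bloch_finSchrodinger (θ : ℝ × ℝ) {V : ℤ × ℤ → ℝ} {v : ZMod p × ZMod q → ℝ}
    (hv : ∀ x, V x = v (cellClass p q x)) (ψ : ℤ × ℤ →₀ ℂ) :
    bloch p q θ (finSchrodinger V ψ) = fiber θ v (bloch p q θ ψ) := by
  have : bloch p q θ ∘ₗ finSchrodinger V = fiber θ v ∘ₗ bloch p q θ := by
    refine Finsupp.lhom_ext' fun x => LinearMap.ext_ring ?_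
    simp only [LinearMap.comp_apply, Finsupp.lsingle_apply, finSchrodinger_single, map_add,
      bloch_single, one_smul, map_smul]
    have w1 : planeWave θ (-(1, 0)) = exp (-(θ.1 * I)) := by simp [planeWave]
    have w2 : planeWave θ (-(-1, 0)) = exp (θ.1 * I) := by simp [planeWave]
    have w3 : planeWave θ (-(0, 1)) = exp (-(θ.2 * I)) := by simp [planeWave]
    have w4 : planeWave θ (-(0, -1)) = exp (θ.2 * I) := by simp [planeWave]
    have c1 : cellClass p q (1, 0) = (1, 0) := by simp [cellClass_apply]
    have c2 : cellClass p q (-1, 0) = (-1, 0) := by simp [cellClass_apply]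
    have c3 : cellClass p q (0, 1) = (0, 1) := by simp [cellClass_apply]
    have c4 : cellClass p q (0, -1) = (0, -1) := by simp [cellClass_apply]
    simp only [neg_add, planeWave_add, w1, w2, w3, w4, c1, c2, c3, c4]
    ext r
    have e1 : (r + (1, 0) = cellClass p q x) = (r = cellClass p q x + (-1, 0)) := by
      rw [show ((-1, 0) : ZMod p × ZMod q) = -(1, 0) by simp, ← sub_eq_add_neg, eq_sub_iff_add_eq]
    have e2 : (r + (-1, 0) = cellClass p q x) = (r = cellClass p q x + (1, 0)) := by
      rw [show ((-1, 0) : ZMod p × ZMod q) = -(1, 0) by simp, ← sub_eq_add_neg, sub_eq_iff_eq_add]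
    have e3 : (r + (0, 1) = cellClass p q x) = (r = cellClass p q x + (0, -1)) := by
      rw [show ((0, -1) : ZMod p × ZMod q) = -(0, 1) by simp, ← sub_eq_add_neg, eq_sub_iff_add_eq]
    have e4 : (r + (0, -1) = cellClass p q x) = (r = cellClass p q x + (0, 1)) := by
      rw [show ((0, -1) : ZMod p × ZMod q) = -(0, 1) by simp, ← sub_eq_add_neg, sub_eq_iff_eq_add]
    simp only [PiLp.add_apply, PiLp.smul_apply, fiber_apply, PiLp.single_apply, e1, e2, e3, e4,
      smul_eq_mul, mul_ite, mul_one, mul_zero, hv]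
    by_cases h : r = cellClass p q x
    · subst h; simp only [if_true]; split_ifs <;> ring
    · simp only [h, if_false]; split_ifs <;> ring
  exact DFunLike.congr_fun this ψ

end Floquet

/-! ### Discrete Parseval identity; the spectrum is contained in the bands. -/

section Parseval

open Complex

variable {p q : ℕ} [NeZero p] [NeZero q]

theorem norm_sq_finToSpace {ψ : ℤ × ℤ →₀ ℂ} {s : Finset (ℤ × ℤ)} (hs : ψ.support ⊆ s) :
    ‖finToSpace ψ‖ ^ 2 = ∑ x ∈ s, ‖ψ x‖ ^ 2 := by
  refine (norm_sq_hasSum (finToSpace ψ)).unique ?_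
  simp only [finToSpace_apply]
  refine hasSum_sum_of_ne_finset_zero fun x hx => ?_
  have : ψ x = 0 := Finsupp.notMem_support_iff.1 fun h => hx (hs h)
  simp [this]

theorem denseRange_finToSpace : DenseRange finToSpace := by
  intro ψ
  have h := lp.hasSum_single (E := fun _ : ℤ × ℤ => ℂ) (p := 2) (by simp) ψ
  refine mem_closure_of_tendsto h (Filter.Eventually.of_forall fun s => ?_)
  refine ⟨∑ x ∈ s, Finsupp.single x (ψ x), ?_⟩
  rw [map_sum]
  refine Finset.sum_congr rfl fun x _ => ?_
  refine lp.ext (funext fun y => ?_)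
  rw [finToSpace_apply, lp.coeFn_single, Finsupp.single_apply]
  by_cases hxy : x = y
  · subst hxy; simp
  · simp [hxy, Ne.symm hxy]

/-- A geometric sum over powers of an `L`-th root of unity; 0 < |k| < L keeps that root different
from 1. -/
theorem sum_range_exp_eq_zero {L : ℕ} {k : ℤ} (hk : k ≠ 0) (hkL : |k| < L) :
    ∑ a : Fin L, exp ((2 * Real.pi * (a : ℕ) / L : ℝ) * k * I) = 0 := by
  have hL : 0 < L := by
    have := abs_nonneg k
    omega
  have hL' : (L : ℂ) ≠ 0 := by exact_mod_cast hL.ne'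
  set ζ := exp (2 * Real.pi * I * k / L)
  have hterm : ∀ a : ℕ, exp ((2 * Real.pi * a / L : ℝ) * k * I) = ζ ^ a := by
    intro a
    rw [← exp_nat_mul]
    congr 1
    push_cast
    ring
  have hone : ζ ^ L = 1 := by
    rw [← exp_nat_mul, exp_eq_one_iff]
    exact ⟨k, by field_simp⟩
  have hne : ζ ≠ 1 := by
    rw [Ne, exp_eq_one_iff]
    rintro ⟨n, hn⟩
    have h2 : (k : ℂ) = n * L := by
      have := two_pi_I_ne_zero
      field_simp at hn
      have h3 : (2 * Real.pi * I : ℂ) * k = (2 * Real.pi * I) * (n * L) := by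
        linear_combination 2 * Real.pi * I * hn
      exact mul_left_cancel₀ this h3
    have h3 : k = n * L := by exact_mod_cast h2
    rw [h3, abs_mul, Nat.abs_cast] at hkL
    have hn0 : n ≠ 0 := by rintro rfl; simp at h3; exact hk h3
    have : 1 ≤ |n| := Int.one_le_abs hn0
    nlinarith
  simp only [hterm]
  rw [Fin.sum_univ_eq_sum_range (fun a => ζ ^ a)]
  have := mul_geom_sum ζ L
  rw [hone, sub_self] at this
  exact (mul_eq_zero.1 this).resolve_left (sub_ne_zero.2 hne)

/-- The points of the uniform `L × L` grid of quasimomenta. -/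
noncomputable def gridPoint {L : ℕ} (a : Fin L × Fin L) : ℝ × ℝ :=
  (2 * Real.pi * (a.1 : ℕ) / L, 2 * Real.pi * (a.2 : ℕ) / L)

theorem gridPoint_mem {L : ℕ} (a : Fin L × Fin L) :
    gridPoint a ∈ Set.Icc ((0, 0) : ℝ × ℝ) (2 * Real.pi, 2 * Real.pi) := by
  have key : ∀ b : Fin L, 0 ≤ 2 * Real.pi * (b : ℕ) / L ∧ 2 * Real.pi * (b : ℕ) / L ≤ 2 * Real.pi := by
    intro b
    have hpi := Real.pi_pos
    have hL : (0 : ℝ) < L := by exact_mod_cast b.pos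
    have hb : ((b : ℕ) : ℝ) ≤ L := by exact_mod_cast b.2.le
    refine ⟨by positivity, ?_⟩
    rw [div_le_iff₀ hL]
    gcongr
  exact ⟨⟨(key a.1).1, (key a.2).1⟩, ⟨(key a.1).2, (key a.2).2⟩⟩

theorem sum_planeWave_gridPoint {L : ℕ} {k : ℤ × ℤ} (hk : k ≠ 0) (h1 : |k.1| < L)
    (h2 : |k.2| < L) : ∑ a : Fin L × Fin L, planeWave (gridPoint a) k = 0 := by
  have hprod : ∀ a : Fin L × Fin L, planeWave (gridPoint a) k
      = exp ((2 * Real.pi * (a.1 : ℕ) / L : ℝ) * k.1 * I)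
        * exp ((2 * Real.pi * (a.2 : ℕ) / L : ℝ) * k.2 * I) := by
    intro a
    rw [planeWave, gridPoint, ← exp_add, add_mul]
  simp only [hprod]
  rw [Fintype.sum_prod_type]
  simp only [← Finset.mul_sum]
  rw [← Finset.sum_mul]
  by_cases hk1 : k.1 = 0
  · have hk2 : k.2 ≠ 0 := fun h => hk (Prod.ext hk1 h)
    rw [sum_range_exp_eq_zero hk2 h2, mul_zero]
  · rw [sum_range_exp_eq_zero hk1 h1, zero_mul]

/-- **Parseval's identity** for the Bloch transform sampled on a fine grid of quasimomenta. -/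
theorem sum_norm_sq_bloch {s : Finset (ℤ × ℤ)} {L : ℕ}
    (hL : ∀ x ∈ s, ∀ y ∈ s, |(x - y).1| < L ∧ |(x - y).2| < L)
    {ψ : ℤ × ℤ →₀ ℂ} (hψ : ψ.support ⊆ s) :
    ∑ a : Fin L × Fin L, ‖bloch p q (gridPoint a) ψ‖ ^ 2 = L ^ 2 * ‖finToSpace ψ‖ ^ 2 := by
  have hexp : ψ = ∑ x ∈ s, Finsupp.single x (ψ x) := by
    conv_lhs => rw [← Finsupp.sum_single ψ]
    exact Finsupp.sum_of_support_subset _ hψ _ (by simp)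
  have hterm : ∀ θ, ((‖bloch p q θ ψ‖ ^ 2 : ℝ) : ℂ) = ∑ x ∈ s, ∑ y ∈ s,
      ((starRingEnd ℂ) (ψ x) * ψ y * inner ℂ (EuclideanSpace.single (cellClass p q x) (1 : ℂ))
        (EuclideanSpace.single (cellClass p q y) (1 : ℂ))) * planeWave θ (x - y) := by
    intro θ
    have hb : bloch p q θ ψ = ∑ x ∈ s, ψ x • planeWave θ (-x) •
        EuclideanSpace.single (cellClass p q x) (1 : ℂ) := by
      conv_lhs => rw [hexp]
      rw [map_sum]
      exact Finset.sum_congr rfl fun x _ => bloch_single θ x _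
    have hconj : ∀ x, (starRingEnd ℂ) (planeWave θ (-x)) = planeWave θ x := by
      intro x
      rw [planeWave, planeWave, ← exp_conj]
      simp
      ring_nf
    rw [ofReal_pow]
    have := inner_self_eq_norm_sq_to_K (𝕜 := ℂ) (bloch p q θ ψ)
    refine this.symm.trans ?_
    rw [hb, sum_inner]
    refine Finset.sum_congr rfl fun x _ => ?_
    rw [inner_sum]
    refine Finset.sum_congr rfl fun y _ => ?_
    rw [inner_smul_left, inner_smul_left, inner_smul_right, inner_smul_right, hconj,
      sub_eq_add_neg, planeWave_add]
    ring
  apply ofReal_injective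
  rw [ofReal_sum]
  simp only [hterm]
  rw [Finset.sum_comm]
  rw [norm_sq_finToSpace hψ]
  push_cast
  rw [Finset.mul_sum]
  refine Finset.sum_congr rfl fun x hx => ?_
  -- Off-diagonal terms cancel by orthogonality on the grid, which is fine enough to separate the
  -- points of `s`.
  rw [Finset.sum_comm, Finset.sum_eq_single x]
  · rw [← Finset.mul_sum]
    have h1 : ∀ θ, planeWave θ (x - x) = 1 := by simp [planeWave]
    have h2 := RCLike.conj_mul (ψ x)
    simp only [h1]
    simp only [EuclideanSpace.inner_single_left, map_one, PiLp.single_apply, if_true,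
      Finset.sum_const, Finset.card_univ, Fintype.card_prod, Fintype.card_fin, nsmul_eq_mul]
    rw [h2]
    push_cast
    simp only [mul_one, coe_algebraMap]
    ring
  · intro y hy hyx
    rw [← Finset.mul_sum, sum_planeWave_gridPoint (sub_ne_zero.2 hyx.symm) (hL x hx y hy).1
      (hL x hx y hy).2, mul_zero]
  · exact fun h => absurd hx h

theorem exists_grid_size (s : Finset (ℤ × ℤ)) :
    ∃ L : ℕ, 0 < L ∧ ∀ x ∈ s, ∀ y ∈ s, |(x - y).1| < L ∧ |(x - y).2| < L := by
  set M := ∑ x ∈ s, (x.1.natAbs + x.2.natAbs)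
  have hM : ∀ x ∈ s, x.1.natAbs + x.2.natAbs ≤ M := fun x hx =>
    Finset.single_le_sum (f := fun x : ℤ × ℤ => x.1.natAbs + x.2.natAbs)
      (fun _ _ => Nat.zero_le _) hx
  refine ⟨2 * M + 1, by omega, fun x hx y hy => ?_⟩
  have h1 := hM x hx
  have h2 := hM y hy
  simp only [Prod.fst_sub, Prod.snd_sub, abs_lt]
  push_cast
  omega

/-- Every point of the spectrum lies on a band. -/
theorem exists_band_eq_of_mem_spectrum {V : Potential} {v : ZMod p × ZMod q → ℝ}
    (hv : ∀ x, V x = v (cellClass p q x)) {E : ℝ} (hE : (E : ℂ) ∈ spectrum ℂ (schrodinger V)) :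
    ∃ θ k, band θ v k = E := by
  by_contra! hne
  set B := Set.Icc ((0, 0) : ℝ × ℝ) (2 * Real.pi, 2 * Real.pi)
  have hB : IsCompact B := isCompact_Icc
  have hBne : B.Nonempty := ⟨0, by
    have := Real.pi_pos
    exact ⟨⟨le_rfl, le_rfl⟩, ⟨by simp; positivity, by simp; positivity⟩⟩⟩
  have hk : ∀ k, ∀ᶠ ε in nhdsWithin (0 : ℝ) (Set.Ioi 0), ∀ θ ∈ B, ε ≤ |band θ v k - E| := by
    intro k
    obtain ⟨η, hη, hmin⟩ := hB.exists_isMinOn hBne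
      (f := fun θ => |band θ v k - E|) (((continuous_band v k).sub continuous_const).abs.continuousOn)
    have hpos : 0 < |band η v k - E| := abs_pos.2 (sub_ne_zero.2 (hne η k))
    filter_upwards [mem_nhdsWithin_of_mem_nhds (Iic_mem_nhds hpos)] with ε hε θ hθ
    exact le_trans hε (hmin hθ)
  obtain ⟨ε, hε, hpos⟩ := ((Filter.eventually_all.2 hk).and self_mem_nhdsWithin).exists
  have hpos : 0 < ε := hpos
  refine notMem_spectrum_of_bounded_below (schrodinger_isSelfAdjoint V) hpos (fun ψ => ?_) hE
  refine denseRange_finToSpace.induction_on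
    (p := fun ψ => ε * ‖ψ‖ ≤ ‖schrodinger V ψ - (E : ℂ) • ψ‖) ψ ?_ fun f => ?_
  · exact isClosed_le (by fun_prop) (by fun_prop)
  · set g := finSchrodinger V f - (E : ℂ) • f
    have hg : schrodinger V (finToSpace f) - (E : ℂ) • finToSpace f = finToSpace g := by
      rw [schrodinger_finToSpace, map_sub, map_smul]
    -- One grid must serve both `f` and `g`, so that the fiberwise bounds can be summed.
    obtain ⟨L, hL0, hL⟩ := exists_grid_size (f.support ∪ g.support)
    have hf := sum_norm_sq_bloch (p := p) (q := q) hL Finset.subset_union_left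
    have hg' := sum_norm_sq_bloch (p := p) (q := q) hL Finset.subset_union_right
    rw [hg]
    refine le_of_sq_le_sq ?_ (norm_nonneg _)
    have hL2 : (0 : ℝ) < L ^ 2 := by positivity
    refine le_of_mul_le_mul_left ?_ hL2
    rw [mul_pow, mul_left_comm, ← hf, ← hg', Finset.mul_sum]
    refine Finset.sum_le_sum fun a _ => ?_
    rw [← mul_pow, map_sub, map_smul, bloch_finSchrodinger _ hv]
    gcongr
    exact mul_norm_le_norm_apply_sub_smul (fiber_isSymmetric _ v) finrank_fiber hpos.le
      (fun k => hε k _ (gridPoint_mem a)) _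

end Parseval

/-! ### Truncated Bloch waves; the bands are contained in the spectrum. -/

section BlochWaves

open Complex

variable {p q : ℕ} [NeZero p] [NeZero q]

/-- The exponential weight `r^{|n| + |m|}`. -/
noncomputable def expWeight (r : ℝ) (x : ℤ × ℤ) : ℝ := r ^ (x.1.natAbs + x.2.natAbs)

theorem expWeight_pos {r : ℝ} (h0 : 0 < r) (x : ℤ × ℤ) : 0 < expWeight r x := pow_pos h0 _

theorem pow_mul_expWeight_le {r : ℝ} (h0 : 0 < r) (h1 : r < 1) (x k : ℤ × ℤ) {d : ℕ}
    (hd : k.1.natAbs + k.2.natAbs ≤ d) : r ^ d * expWeight r x ≤ expWeight r (x + k) := by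
  rw [expWeight, expWeight, ← pow_add]
  refine pow_le_pow_of_le_one h0.le h1.le ?_
  simp only [Prod.fst_add, Prod.snd_add]
  omega

/-- A unit step changes the weight by a factor between r and 1/r, and 1 − r ≤ 1/r − 1. -/
theorem abs_expWeight_sub_le {r : ℝ} (h0 : 0 < r) (h1 : r < 1) (x k : ℤ × ℤ)
    (hk : k.1.natAbs + k.2.natAbs ≤ 1) :
    |expWeight r (x + k) - expWeight r x| ≤ (r⁻¹ - 1) * expWeight r x := by
  have e1 := pow_mul_expWeight_le h0 h1 x k hk
  have e2 := pow_mul_expWeight_le h0 h1 (x + k) (-k) (d := 1) (by simpa using hk)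
  rw [add_neg_cancel_right] at e2
  rw [pow_one] at e1 e2
  have hx := expWeight_pos h0 x
  have e3 : expWeight r (x + k) ≤ r⁻¹ * expWeight r x := by
    rw [inv_mul_eq_div, le_div_iff₀ h0]; linarith
  have e4 : 1 - r ≤ r⁻¹ - 1 := by
    have : r * r⁻¹ = 1 := mul_inv_cancel₀ h0.ne'
    nlinarith [sq_nonneg (r - 1), inv_pos.2 h0]
  rw [abs_le]
  constructor <;> nlinarith

theorem summable_expWeight {r : ℝ} (h0 : 0 < r) (h1 : r < 1) : Summable (expWeight r) := by
  have h : Summable fun n : ℤ => r ^ n.natAbs := by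
    refine Summable.of_nat_of_neg ?_ ?_ <;>
    simpa using summable_geometric_of_lt_one h0.le h1
  have := h.mul_of_nonneg h (fun _ => by positivity) (fun _ => by positivity)
  refine this.congr fun x => ?_
  rw [expWeight, pow_add]

theorem memℓp_two_of_norm_le_expWeight {r : ℝ} (h0 : 0 < r) (h1 : r < 1) {f : ℤ × ℤ → ℂ} {A : ℝ}
    (hf : ∀ x, ‖f x‖ ≤ A * expWeight r x) : Memℓp f 2 := by
  refine (memℓp_gen_iff (by norm_num)).2 ?_
  have hr2 : r ^ 2 < 1 := by nlinarith
  refine Summable.of_nonneg_of_le (fun x => by positivity) (fun x => ?_)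
    ((summable_expWeight (pow_pos h0 2) hr2).mul_left (A ^ 2))
  have h2 : expWeight (r ^ 2) x = expWeight r x ^ 2 := by
    rw [expWeight, expWeight, ← pow_mul, ← pow_mul, mul_comm]
  rw [h2, ← mul_pow]
  simp only [ENNReal.toReal_ofNat, Real.rpow_ofNat]
  gcongr
  exact hf x

theorem norm_le_mul_norm_of_forall {f g : Space} {c : ℝ} (hc : 0 ≤ c)
    (h : ∀ x, ‖f x‖ ≤ c * ‖g x‖) : ‖f‖ ≤ c * ‖g‖ := by
  refine le_of_sq_le_sq ?_ (by positivity)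
  rw [mul_pow]
  refine hasSum_le (fun x => ?_) (norm_sq_hasSum f) ((norm_sq_hasSum g).mul_left (c ^ 2))
  rw [← mul_pow]
  gcongr
  exact h x

/-- Every band value lies in the spectrum. -/
theorem band_mem_spectrum {V : Potential} {v : ZMod p × ZMod q → ℝ}
    (hv : ∀ x, V x = v (cellClass p q x)) (θ : ℝ × ℝ) (k : Fin (p * q)) :
    ((band θ v k : ℝ) : ℂ) ∈ spectrum ℂ (schrodinger V) := by
  by_contra hnot
  obtain ⟨C, hC, hbound⟩ := exists_bounded_below_of_notMem_spectrum hnot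
  set E := band θ v k
  obtain ⟨hu, hu0⟩ := (fiber_isSymmetric θ v).hasEigenvector_eigenvectorBasis finrank_fiber k
  set u := (fiber_isSymmetric θ v).eigenvectorBasis finrank_fiber k
  have hu : fiber θ v u = (E : ℂ) • u := Module.End.mem_eigenspace_iff.1 hu
  have hA : 0 < ‖u‖ := norm_pos_iff.2 hu0
  -- The Bloch wave is a bounded solution of HΨ = EΨ. Multiplying it by an exponential weight gives
  -- ℓ² approximate eigenvectors.
  set Ψ : ℤ × ℤ → ℂ := fun x => planeWave θ x * u (cellClass p q x)
  have hΨn : ∀ x, ‖Ψ x‖ = ‖u (cellClass p q x)‖ := fun x => by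
    simp only [Ψ, norm_mul, norm_planeWave, one_mul]
  have hΨ : ∀ x, ‖Ψ x‖ ≤ ‖u‖ := fun x => (hΨn x).trans_le (PiLp.norm_apply_le u _)
  have hbloch : ∀ x, Ψ (x + (1, 0)) + Ψ (x + (-1, 0)) + Ψ (x + (0, 1)) + Ψ (x + (0, -1))
      + V x * Ψ x = E * Ψ x := by
    intro x
    have h := congrArg (fun w : Fiber p q => w (cellClass p q x)) hu
    simp only [fiber_apply, PiLp.smul_apply, smul_eq_mul] at h
    have w1 : planeWave θ (1, 0) = exp (θ.1 * I) := by simp [planeWave]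
    have w2 : planeWave θ (-1, 0) = exp (-(θ.1 * I)) := by simp [planeWave]
    have w3 : planeWave θ (0, 1) = exp (θ.2 * I) := by simp [planeWave]
    have w4 : planeWave θ (0, -1) = exp (-(θ.2 * I)) := by simp [planeWave]
    have c1 : cellClass p q (1, 0) = (1, 0) := by simp [cellClass_apply]
    have c2 : cellClass p q (-1, 0) = (-1, 0) := by simp [cellClass_apply]
    have c3 : cellClass p q (0, 1) = (0, 1) := by simp [cellClass_apply]
    have c4 : cellClass p q (0, -1) = (0, -1) := by simp [cellClass_apply]
    simp only [Ψ, planeWave_add, map_add, w1, w2, w3, w4, c1, c2, c3, c4, hv]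
    linear_combination planeWave θ x * h
  -- The resolvent bound `C` compares the size of the truncated wave with its residual, which comes
  -- only from differences of the weight and is of order 1/r − 1.
  have main : ∀ r : ℝ, 0 < r → r < 1 →
      r ^ (p + q) ≤ (p * q : ℝ) * (C * (4 * (r⁻¹ - 1))) := by
    intro r h0 h1
    have hr : 0 < r⁻¹ - 1 := by
      have := (one_lt_inv₀ h0).2 h1
      linarith
    have hχn : ∀ x, ‖(expWeight r x : ℂ)‖ = expWeight r x := fun x => by
      rw [norm_real, Real.norm_eq_abs, abs_of_pos (expWeight_pos h0 x)]
    let χ : Space := ⟨fun x => (expWeight r x : ℂ),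
      memℓp_two_of_norm_le_expWeight h0 h1 (A := 1) fun x => by rw [hχn, one_mul]⟩
    let ψ : Space := ⟨fun x => (expWeight r x : ℂ) * Ψ x,
      memℓp_two_of_norm_le_expWeight h0 h1 (A := ‖u‖) fun x => by
        rw [norm_mul, hχn, mul_comm]
        exact mul_le_mul_of_nonneg_right (hΨ x) (expWeight_pos h0 x).le⟩
    have hχ : ∀ x, χ x = (expWeight r x : ℂ) := fun _ => rfl
    have hψ : ∀ x, ψ x = (expWeight r x : ℂ) * Ψ x := fun _ => rfl
    have hχpos : 0 < ‖χ‖ := by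
      refine norm_pos_iff.2 fun h => ?_
      have h2 : χ 0 = 0 := by rw [h]; rfl
      rw [hχ] at h2
      exact (expWeight_pos h0 0).ne' (ofReal_eq_zero.1 h2)
    have upper : ‖schrodinger V ψ - (E : ℂ) • ψ‖ ≤ (4 * (r⁻¹ - 1) * ‖u‖) * ‖χ‖ := by
      refine norm_le_mul_norm_of_forall (by positivity) fun x => ?_
      have hH : schrodinger V ψ x = ψ (x + (1, 0)) + ψ (x + (-1, 0)) + ψ (x + (0, 1))
          + ψ (x + (0, -1)) + V x * ψ x := by
        obtain ⟨n, m⟩ := x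
        rw [schrodinger_apply]
        simp only [Prod.mk_add_mk, add_zero, sub_eq_add_neg]
        ring
      have hdiff : (schrodinger V ψ - (E : ℂ) • ψ) x
          = ((expWeight r (x + (1, 0)) - expWeight r x : ℝ) : ℂ) * Ψ (x + (1, 0))
          + ((expWeight r (x + (-1, 0)) - expWeight r x : ℝ) : ℂ) * Ψ (x + (-1, 0))
          + ((expWeight r (x + (0, 1)) - expWeight r x : ℝ) : ℂ) * Ψ (x + (0, 1))
          + ((expWeight r (x + (0, -1)) - expWeight r x : ℝ) : ℂ) * Ψ (x + (0, -1)) := by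
        rw [lp.coeFn_sub, Pi.sub_apply, lp.coeFn_smul, Pi.smul_apply, smul_eq_mul, hH]
        simp only [hψ]
        push_cast
        linear_combination (expWeight r x : ℂ) * hbloch x
      have hterm : ∀ e : ℤ × ℤ, e.1.natAbs + e.2.natAbs ≤ 1 →
          ‖((expWeight r (x + e) - expWeight r x : ℝ) : ℂ) * Ψ (x + e)‖
            ≤ (r⁻¹ - 1) * expWeight r x * ‖u‖ := by
        intro e he
        rw [norm_mul, norm_real, Real.norm_eq_abs]
        exact mul_le_mul (abs_expWeight_sub_le h0 h1 x e he) (hΨ _) (norm_nonneg _)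
          (mul_nonneg hr.le (expWeight_pos h0 x).le)
      rw [hdiff, hχ, hχn]
      refine (norm_add₄_le).trans ?_
      have := hterm (1, 0) (by simp)
      have := hterm (-1, 0) (by simp)
      have := hterm (0, 1) (by simp)
      have := hterm (0, -1) (by simp)
      linarith
    -- Since `u` may vanish at some sites, no pointwise lower bound holds. Summing over the
    -- translates by one cell collects all of ‖u‖², and the weight loses at most a factor r^(p+q).
    have lower : r ^ (p + q) * ‖u‖ * ‖χ‖ ≤ (p * q : ℝ) * ‖ψ‖ := by
      let κ : ZMod p × ZMod q → ℤ × ℤ := fun s => (s.1.val, s.2.val)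
      have hκ : ∀ s, cellClass p q (κ s) = s := fun s => by
        simp [κ, cellClass_apply]
      have hpt : ∀ x, (r ^ (p + q) * ‖u‖) ^ 2 * ‖χ x‖ ^ 2
          ≤ ∑ s, ‖shift (κ s) ψ x‖ ^ 2 := by
        intro x
        have hu2 : ‖u‖ ^ 2 = ∑ s, ‖u (cellClass p q x + s)‖ ^ 2 := by
          rw [EuclideanSpace.norm_sq_eq]
          exact (Equiv.sum_comp (Equiv.addLeft (cellClass p q x)) fun s => ‖u s‖ ^ 2).symm
        rw [mul_pow, hu2, mul_right_comm, Finset.mul_sum]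
        refine Finset.sum_le_sum fun s _ => ?_
        rw [shift_apply, hψ, norm_mul, hΨn, map_add, hκ, hχ, hχn, hχn, mul_pow, ← mul_pow]
        gcongr
        · have := (expWeight_pos h0 x).le
          positivity
        · refine pow_mul_expWeight_le h0 h1 x (κ s) ?_
          have a1 := ZMod.val_lt s.1
          have a2 := ZMod.val_lt s.2
          simp only [κ, Int.natAbs_natCast]
          omega
      have h2 : (r ^ (p + q) * ‖u‖) ^ 2 * ‖χ‖ ^ 2 ≤ ∑ s, ‖shift (κ s) ψ‖ ^ 2 :=
        hasSum_le hpt ((norm_sq_hasSum χ).mul_left _)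
          (hasSum_sum fun s _ => norm_sq_hasSum (shift (κ s) ψ))
      have h3 : ∑ s, ‖shift (κ s) ψ‖ ^ 2 ≤ (p * q : ℝ) * ‖ψ‖ ^ 2 := by
        refine (Finset.sum_le_card_nsmul _ _ (‖ψ‖ ^ 2) fun s _ => ?_).trans_eq ?_
        · gcongr
          exact norm_shift_le _ _
        · simp [ZMod.card]
      have hpq : (1 : ℝ) ≤ p * q := by
        exact_mod_cast Nat.mul_pos (Nat.pos_of_ne_zero (NeZero.ne p))
          (Nat.pos_of_ne_zero (NeZero.ne q))
      refine le_of_sq_le_sq ?_ (by positivity)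
      rw [mul_pow, mul_pow (_ * _ : ℝ) ‖ψ‖]
      refine h2.trans (h3.trans ?_)
      gcongr
      nlinarith
    have h4 := hbound ψ
    have h5 : r ^ (p + q) * ‖u‖ * ‖χ‖
        ≤ ((p * q : ℝ) * (C * (4 * (r⁻¹ - 1)))) * ‖u‖ * ‖χ‖ := by
      calc r ^ (p + q) * ‖u‖ * ‖χ‖ ≤ (p * q : ℝ) * ‖ψ‖ := lower
        _ ≤ (p * q : ℝ) * (C * ((4 * (r⁻¹ - 1) * ‖u‖) * ‖χ‖)) := by
          gcongr
          exact h4.trans (mul_le_mul_of_nonneg_left upper hC)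
        _ = _ := by ring
    exact le_of_mul_le_mul_right (le_of_mul_le_mul_right h5 hχpos) hA
  have t1 : Filter.Tendsto (fun r : ℝ => r ^ (p + q)) (nhdsWithin 1 (Set.Iio 1)) (nhds 1) := by
    have : ContinuousAt (fun r : ℝ => r ^ (p + q)) 1 := by fun_prop
    simpa using this.tendsto.mono_left nhdsWithin_le_nhds
  have t2 : Filter.Tendsto (fun r : ℝ => (p * q : ℝ) * (C * (4 * (r⁻¹ - 1))))
      (nhdsWithin 1 (Set.Iio 1)) (nhds 0) := by
    have : ContinuousAt (fun r : ℝ => (p * q : ℝ) * (C * (4 * (r⁻¹ - 1)))) 1 := by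
      fun_prop (disch := norm_num)
    simpa using this.tendsto.mono_left nhdsWithin_le_nhds
  -- Letting r → 1 from below in `main` gives 1 ≤ 0.
  have := le_of_tendsto_of_tendsto t1 t2 (by
    filter_upwards [self_mem_nhdsWithin,
      mem_nhdsWithin_of_mem_nhds (lt_mem_nhds (zero_lt_one (α := ℝ)))] with r hr hr0
    exact main r hr0 hr)
  linarith

end BlochWaves

/-! ### Touching free bands, overlap margins, and the spectrum as a union of bands. -/

section Bands

variable {p q : ℕ} [NeZero p] [NeZero q]

/-- Indices start at 0 and bands decrease, so only the n + 1 indices before n + 1 can have a value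
above `E`. -/
theorem gridCount_le_of_band_le {n : ℕ} (hn : n + 1 < p * q) {E : ℝ}
    (h : ∀ θ, band (p := p) (q := q) θ 0 ⟨n + 1, hn⟩ ≤ E) (x y : ℝ) :
    gridCount p q (E < ·) x y ≤ n + 1 := by
  classical
  rw [← card_filter_band_zero (p := p) (q := q) (x, y)]
  refine (Finset.card_le_card (t := Finset.Iio ⟨n + 1, hn⟩) fun j hj => ?_).trans_eq
    (Fin.card_Iio _)
  rw [Finset.mem_Iio]
  by_contra! hjn
  have h1 := (Finset.mem_filter.1 hj).2
  linarith [band_antitone (p := p) (q := q) (x, y) 0 hjn, h (x, y)]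

theorem le_gridCount_of_le_band {n : ℕ} (hn : n < p * q) {E : ℝ}
    (h : ∀ θ, E ≤ band (p := p) (q := q) θ 0 ⟨n, hn⟩) (x y : ℝ) :
    n + 1 ≤ gridCount p q (E ≤ ·) x y := by
  classical
  rw [← card_filter_band_zero (p := p) (q := q) (x, y)]
  refine (Fin.card_Iic ⟨n, hn⟩).symm.trans_le (Finset.card_le_card fun j hj => ?_)
  exact Finset.mem_filter.2 ⟨Finset.mem_univ _,
    (h (x, y)).trans (band_antitone (p := p) (q := q) (x, y) 0 (Finset.mem_Iic.1 hj))⟩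

/-- The consecutive free bands `n` and `n + 1` do not overlap in an interval of positive length. -/
def IsTouching (p q : ℕ) [NeZero p] [NeZero q] (n : ℕ) : Prop :=
  ∃ h : n + 1 < p * q, ∀ θ η,
    band (p := p) (q := q) η 0 ⟨n + 1, h⟩ ≤ band (p := p) (q := q) θ 0 ⟨n, by omega⟩

theorem pinched_energy {n : ℕ} (hn : n + 1 < p * q) {E : ℝ}
    (h1 : ∀ θ, band (p := p) (q := q) θ 0 ⟨n + 1, hn⟩ ≤ E)
    (h2 : ∀ θ, E ≤ band (p := p) (q := q) θ 0 ⟨n, by omega⟩) : E = 0 ∧ Even p ∧ Even q :=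
  energy_eq_zero_and_even_of_gridCount (Nat.pos_of_ne_zero (NeZero.ne p))
    (Nat.pos_of_ne_zero (NeZero.ne q)) (Nat.succ_pos n) hn (gridCount_le_of_band_le hn h1)
    (le_gridCount_of_le_band _ h2)

namespace IsTouching

variable {n : ℕ}

theorem bddBelow_band (hn : IsTouching p q n) :
    BddBelow (Set.range fun θ => band (p := p) (q := q) θ 0 ⟨n, by have := hn.1; omega⟩) := by
  refine ⟨band (p := p) (q := q) 0 0 ⟨n + 1, hn.1⟩, ?_⟩
  rintro _ ⟨θ, rfl⟩
  exact hn.2 θ 0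

theorem bddAbove_band (hn : IsTouching p q n) :
    BddAbove (Set.range fun θ => band (p := p) (q := q) θ 0 ⟨n + 1, hn.1⟩) := by
  refine ⟨band (p := p) (q := q) 0 0 ⟨n, by have := hn.1; omega⟩, ?_⟩
  rintro _ ⟨η, rfl⟩
  exact hn.2 0 η

/-- The infimum of the upper band is itself a separating energy, so the pinching result applies to
it; `iSup_band` uses the supremum of the lower band in the same way. -/
theorem iInf_band (hn : IsTouching p q n) :
    (⨅ θ, band (p := p) (q := q) θ 0 ⟨n, by have := hn.1; omega⟩) = 0 ∧ Even p ∧ Even q :=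
  pinched_energy hn.1 (fun η => le_ciInf fun θ => hn.2 θ η) fun θ => ciInf_le hn.bddBelow_band θ

theorem iSup_band (hn : IsTouching p q n) :
    (⨆ θ, band (p := p) (q := q) θ 0 ⟨n + 1, hn.1⟩) = 0 :=
  (pinched_energy hn.1 (fun η => le_ciSup hn.bddAbove_band η)
    fun θ => ciSup_le fun η => hn.2 θ η).1

theorem nonneg_band (hn : IsTouching p q n) (θ : ℝ × ℝ) :
    0 ≤ band (p := p) (q := q) θ 0 ⟨n, by have := hn.1; omega⟩ :=
  hn.iInf_band.1.ge.trans (ciInf_le hn.bddBelow_band θ)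

theorem band_nonpos (hn : IsTouching p q n) (θ : ℝ × ℝ) :
    band (p := p) (q := q) θ 0 ⟨n + 1, hn.1⟩ ≤ 0 :=
  (le_ciSup hn.bddAbove_band θ).trans hn.iSup_band.le

/-- At most one pair of consecutive free bands merely touches. -/
theorem unique {m : ℕ} (hn : IsTouching p q n) (hm : IsTouching p q m) : n = m := by
  have := eq_of_gridCount (p := p) (Nat.pos_of_ne_zero (NeZero.ne q))
    (gridCount_le_of_band_le hn.1 hn.band_nonpos)
    (le_gridCount_of_le_band _ hn.nonneg_band) (gridCount_le_of_band_le hm.1 hm.band_nonpos)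
    (le_gridCount_of_le_band _ hm.nonneg_band)
  omega

end IsTouching

/-- Free bands which do not merely touch overlap by a uniform margin. -/
theorem exists_overlap_margin (p q : ℕ) [NeZero p] [NeZero q] :
    ∃ C : ℝ, 0 < C ∧ C ≤ 1 ∧ ∀ n (h : n + 1 < p * q), ¬ IsTouching p q n →
      ∃ θ η, band (p := p) (q := q) θ 0 ⟨n, by omega⟩ + 2 * C
        ≤ band (p := p) (q := q) η 0 ⟨n + 1, h⟩ := by
  -- For each k every sufficiently small `C` works; there are finitely many k, so one `C` works for
  -- all.
  have hk : ∀ k : Fin (p * q), ∀ᶠ C in nhdsWithin (0 : ℝ) (Set.Ioi 0),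
      ∀ h : (k : ℕ) + 1 < p * q, ¬ IsTouching p q k →
      ∃ θ η, band (p := p) (q := q) θ 0 k + 2 * C ≤ band (p := p) (q := q) η 0 ⟨k + 1, h⟩ := by
    intro k
    by_cases hb : ∃ h : (k : ℕ) + 1 < p * q, ∃ θ η,
        band (p := p) (q := q) θ 0 k < band (p := p) (q := q) η 0 ⟨k + 1, h⟩
    · obtain ⟨h, θ, η, hlt⟩ := hb
      filter_upwards [mem_nhdsWithin_of_mem_nhds (Iic_mem_nhds (half_pos (sub_pos.2 hlt)))]
        with C hC _ _
      have hC : C ≤ _ := hC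
      exact ⟨θ, η, by linarith⟩
    · push Not at hb
      exact Filter.Eventually.of_forall fun C h ht => absurd ⟨h, hb h⟩ ht
  obtain ⟨C, hC, hC1, hC0⟩ := ((Filter.eventually_all.2 hk).and
    ((Filter.eventually_of_mem (mem_nhdsWithin_of_mem_nhds (Iic_mem_nhds one_pos))
      fun _ h => h).and self_mem_nhdsWithin)).exists
  exact ⟨C, hC0, hC1, fun n h => hC ⟨n, by omega⟩ h⟩

/-- The set of values of the `n`-th band function. -/
def bandSet (v : ZMod p × ZMod q → ℝ) (n : ℕ) : Set ℝ :=
  {E | ∃ h : n < p * q, ∃ θ, band θ v ⟨n, h⟩ = E}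

theorem isPreconnected_bandSet (v : ZMod p × ZMod q → ℝ) (n : ℕ) :
    IsPreconnected (bandSet v n) := by
  by_cases h : n < p * q
  · have : bandSet v n = Set.range fun θ => band θ v ⟨n, h⟩ := by
      ext E; simp [bandSet, h]
    rw [this]
    exact isPreconnected_range (continuous_band v _)
  · have : bandSet v n = ∅ := by
      ext E; simp [bandSet, h]
    rw [this]
    exact isPreconnected_empty

/-- The common point is the value of band n + 1 at η: it lies between the values of band n at θ and
at η, and that range is an interval. -/
theorem bandSet_inter_nonempty {v : ZMod p × ZMod q → ℝ} {n : ℕ} (h : n + 1 < p * q)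
    (hov : ∃ θ η, band θ v ⟨n, by omega⟩ ≤ band η v ⟨n + 1, h⟩) :
    (bandSet v n ∩ bandSet v (n + 1)).Nonempty := by
  obtain ⟨θ, η, hle⟩ := hov
  refine ⟨band η v ⟨n + 1, h⟩, ?_, h, η, rfl⟩
  have hn : n < p * q := by omega
  exact (isPreconnected_bandSet v n).ordConnected.out ⟨hn, θ, rfl⟩ ⟨hn, η, rfl⟩
    ⟨hle, band_antitone η v (Fin.mk_le_mk.2 (Nat.le_succ n))⟩

theorem spectrum_eq_image_iUnion_bandSet {V : Potential} {v : ZMod p × ZMod q → ℝ}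
    (hv : ∀ x, V x = v (cellClass p q x)) :
    spectrum ℂ (schrodinger V) = Complex.ofReal '' ⋃ n, bandSet v n := by
  ext z
  constructor
  · intro hz
    have hre := (schrodinger_isSelfAdjoint V).mem_spectrum_eq_re hz
    rw [hre] at hz
    obtain ⟨θ, k, hk⟩ := exists_band_eq_of_mem_spectrum hv hz
    exact ⟨z.re, Set.mem_iUnion.2 ⟨k, k.2, θ, hk⟩, hre.symm⟩
  · rintro ⟨E, hE, rfl⟩
    obtain ⟨n, h, θ, rfl⟩ := Set.mem_iUnion.1 hE
    exact band_mem_spectrum hv θ _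

theorem ofReal_mem_spectrum_iff {V : Potential} {v : ZMod p × ZMod q → ℝ}
    (hv : ∀ x, V x = v (cellClass p q x)) (E : ℝ) :
    (E : ℂ) ∈ spectrum ℂ (schrodinger V) ↔ ∃ n, E ∈ bandSet v n := by
  rw [spectrum_eq_image_iUnion_bandSet hv, Complex.ofReal_injective.mem_set_image,
    Set.mem_iUnion]

/-- The constant wave has energy 4. With its counterpart at −4 this shows that the spectrum is not a
single point. -/
theorem exists_four_le_band : ∃ k, 4 ≤ band (p := p) (q := q) (0, 0) 0 k := by
  classical
  have hcard : 0 < gridCount p q (4 ≤ ·) 0 0 := by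
    refine Finset.card_pos.2 ⟨(⟨0, Nat.pos_of_ne_zero (NeZero.ne p)⟩,
      ⟨0, Nat.pos_of_ne_zero (NeZero.ne q)⟩), ?_⟩
    simp
    norm_num
  rw [← card_filter_band_zero (p := p) (q := q) (0, 0)] at hcard
  obtain ⟨k, hk⟩ := Finset.card_pos.1 hcard
  exact ⟨k, (Finset.mem_filter.1 hk).2⟩

theorem exists_band_le_neg_four :
    ∃ k, band (p := p) (q := q) (Real.pi, Real.pi) 0 k ≤ -4 := by
  classical
  have hcard : 0 < gridCount p q (· ≤ -4) Real.pi Real.pi := by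
    refine Finset.card_pos.2 ⟨(⟨0, Nat.pos_of_ne_zero (NeZero.ne p)⟩,
      ⟨0, Nat.pos_of_ne_zero (NeZero.ne q)⟩), ?_⟩
    simp
    norm_num
  rw [← card_filter_band_zero (p := p) (q := q) (Real.pi, Real.pi) (P := (· ≤ -4))] at hcard
  obtain ⟨k, hk⟩ := Finset.card_pos.1 hcard
  exact ⟨k, (Finset.mem_filter.1 hk).2⟩

end Bands

/-- Each preconnected piece lies in one component. An empty piece is assigned an arbitrary
component, so `A` and `B` need not be nonempty. -/
theorem card_connectedComponents_le_two {X : Type*} [TopologicalSpace X] {s A B : Set X}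
    (hs : s = A ∪ B) (hA : IsPreconnected A) (hB : IsPreconnected B) :
    ENat.card (ConnectedComponents s) ≤ 2 := by
  have key : ∀ D ⊆ s, IsPreconnected D → Nonempty (ConnectedComponents s) →
      ∃ c : ConnectedComponents s, ∀ x : s, (x : X) ∈ D → (x : ConnectedComponents s) = c := by
    intro D hD hpre ⟨c⟩
    by_cases hne : ∃ x : s, (x : X) ∈ D
    · obtain ⟨x, hx⟩ := hne
      refine ⟨x, fun y hy => ConnectedComponents.coe_eq_coe'.2 ?_⟩
      have hpre' : IsPreconnected ((↑) ⁻¹' D : Set s) := by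
        rw [← Topology.IsInducing.subtypeVal.isPreconnected_image, Subtype.image_preimage_coe,
          Set.inter_eq_right.2 hD]
        exact hpre
      exact hpre'.subset_connectedComponent hx hy
    · exact ⟨c, fun x hx => absurd ⟨x, hx⟩ hne⟩
  rcases isEmpty_or_nonempty (ConnectedComponents s) with h | h
  · rw [← Set.encard_univ, Set.univ_eq_empty_iff.2 h]
    simp
  obtain ⟨a, ha⟩ := key A (hs ▸ Set.subset_union_left) hA h
  obtain ⟨b, hb⟩ := key B (hs ▸ Set.subset_union_right) hB h
  have huniv : (Set.univ : Set (ConnectedComponents s)) ⊆ {a, b} := by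
    intro c _
    obtain ⟨x, rfl⟩ := ConnectedComponents.surjective_coe c
    have hx : (x : X) ∈ A ∪ B := hs ▸ x.2
    exact hx.imp (ha x) (hb x)
  rw [← Set.encard_univ]
  exact (Set.encard_le_encard huniv).trans ((Set.encard_insert_le _ _).trans
    (by rw [Set.encard_singleton, one_add_one_eq_two]))

end LatticeSchrodinger

/-! ### Assembly of the main theorem. -/

open LatticeSchrodinger in
theorem theorem1p1 (p q : ℕ) (hp : 0 < p) (hq : 0 < q) :
    ∃ C : ℝ, 0 < C ∧
      ∀ V : LatticeSchrodinger.Potential, LatticeSchrodinger.IsPeriodic p q V → ‖V‖ ≤ C →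
        -- the spectrum has at most two connected components
        ENat.card (ConnectedComponents (spectrum ℂ (LatticeSchrodinger.schrodinger V))) ≤ 2 ∧
        -- if a period is odd, the spectrum is a single (nondegenerate compact real) interval
        (Odd p ∨ Odd q → ∃ a b : ℝ, a < b ∧
          spectrum ℂ (LatticeSchrodinger.schrodinger V) = Complex.ofReal '' Set.Icc a b) ∧
        -- a gap can open only at energy `0`: every gap is contained in `[-‖V‖, ‖V‖]`
        (∀ E₁ E E₂ : ℝ, E₁ < E → E < E₂ →
          (E₁ : ℂ) ∈ spectrum ℂ (LatticeSchrodinger.schrodinger V) →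
          (E₂ : ℂ) ∈ spectrum ℂ (LatticeSchrodinger.schrodinger V) →
          (E : ℂ) ∉ spectrum ℂ (LatticeSchrodinger.schrodinger V) → |E| ≤ ‖V‖) := by
  have : NeZero p := ⟨hp.ne'⟩
  have : NeZero q := ⟨hq.ne'⟩
  obtain ⟨C, hC0, hC1, hC⟩ := exists_overlap_margin p q
  refine ⟨C, hC0, fun V hV hVC => ?_⟩
  obtain ⟨v, hv, hvV⟩ := hV.exists_cell
  have hpert : ∀ θ k, |band θ v k - band θ 0 k| ≤ ‖V‖ := fun θ k =>
    abs_band_sub_band_le θ (norm_nonneg V) (fun r => by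
      obtain ⟨x, hx⟩ := hvV r
      rw [Pi.zero_apply, sub_zero, hx]
      exact lp.norm_apply_le_norm (by simp) V x) k
  have hover : ∀ n (h : n + 1 < p * q), ¬ IsTouching p q n →
      ∃ θ η, band θ v ⟨n, by omega⟩ ≤ band η v ⟨n + 1, h⟩ := by
    intro n h ht
    -- The margin 2C absorbs the displacement of both bands, each at most ‖V‖ ≤ C.
    obtain ⟨θ, η, hle⟩ := hC n h ht
    refine ⟨θ, η, ?_⟩
    have h1 := (abs_le.1 (hpert θ ⟨n, by omega⟩)).2
    have h2 := (abs_le.1 (hpert η ⟨n + 1, h⟩)).1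
    linarith
  have hchain : ∀ t : Set ℕ, t.OrdConnected → t ⊆ Set.Iio (p * q) →
      (∀ n ∈ t, n + 1 ∈ t → ¬ IsTouching p q n) → IsPreconnected (⋃ n ∈ t, bandSet v n) := by
    intro t ht hlt hnt
    exact IsPreconnected.biUnion_of_chain ht (fun n _ => isPreconnected_bandSet v n)
      fun n hn hn' => bandSet_inter_nonempty (hlt hn') (hover n (hlt hn') (hnt n hn hn'))
  have hspec := spectrum_eq_image_iUnion_bandSet hv
  have hIio : ⋃ n, bandSet v n = ⋃ n ∈ Set.Iio (p * q), bandSet v n := by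
    refine Set.Subset.antisymm (fun E hE => ?_)
      (Set.iUnion₂_subset fun n _ => Set.subset_iUnion (bandSet v) n)
    obtain ⟨n, h, hn⟩ := Set.mem_iUnion.1 hE
    exact Set.mem_iUnion₂.2 ⟨n, h, h, hn⟩
  refine ⟨?_, fun hodd => ?_, fun E₁ E E₂ h1 h2 hE₁ hE₂ hE => ?_⟩
  · by_cases ht : ∃ K, IsTouching p q K
    · obtain ⟨K, hK⟩ := ht
      have hKN := hK.1
      -- The only place where the chain of overlapping bands can break is after the unique touching
      -- index `K`.
      have hsplit : ⋃ n, bandSet v n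
          = (⋃ n ∈ Set.Iic K, bandSet v n) ∪ ⋃ n ∈ Set.Ioo K (p * q), bandSet v n := by
        have : Set.Iio (p * q) = Set.Iic K ∪ Set.Ioo K (p * q) := by
          ext n
          simp only [Set.mem_Iio, Set.mem_union, Set.mem_Iic, Set.mem_Ioo]
          omega
        rw [hIio, this, Set.biUnion_union]
      rw [hsplit, Set.image_union] at hspec
      refine card_connectedComponents_le_two hspec
        (IsPreconnected.image (hchain _ Set.ordConnected_Iic ?_ ?_) _
          Complex.continuous_ofReal.continuousOn)
        (IsPreconnected.image (hchain _ Set.ordConnected_Ioo (fun n hn => hn.2) ?_) _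
          Complex.continuous_ofReal.continuousOn)
      · intro n hn
        have : n ≤ K := hn
        exact Set.mem_Iio.2 (by omega)
      · intro n _ hn hnt
        have hn : n + 1 ≤ K := hn
        have := hnt.unique hK
        omega
      · intro n hn _ hnt
        have := hnt.unique hK
        have := hn.1
        omega
    · push Not at ht
      have hconn := hchain _ Set.ordConnected_Iio subset_rfl fun n _ _ => ht n
      rw [← hIio] at hconn
      exact card_connectedComponents_le_two (hspec.trans (Set.union_self _).symm)
        (hconn.image _ Complex.continuous_ofReal.continuousOn)
        (hconn.image _ Complex.continuous_ofReal.continuousOn)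
  · have hnt : ∀ n, ¬ IsTouching p q n := fun n hn => by
      obtain ⟨-, hpe, hqe⟩ := hn.iInf_band
      exact hodd.elim (Nat.not_odd_iff_even.2 hpe) (Nat.not_odd_iff_even.2 hqe)
    have hconn := hchain _ Set.ordConnected_Iio subset_rfl fun n _ _ => hnt n
    rw [← hIio] at hconn
    have hcomp : IsCompact (⋃ n, bandSet v n) := by
      have := (spectrum.isCompact (𝕜 := ℂ) (schrodinger V)).image Complex.continuous_re
      rw [hspec, Set.image_image] at this
      simpa using this
    obtain ⟨k, hk⟩ := exists_four_le_band (p := p) (q := q)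
    obtain ⟨l, hl⟩ := exists_band_le_neg_four (p := p) (q := q)
    have hmem : ∀ θ (k : Fin (p * q)), band θ v k ∈ ⋃ n, bandSet v n := fun θ k =>
      Set.mem_iUnion.2 ⟨k, k.2, θ, rfl⟩
    have hIcc := eq_Icc_of_connected_compact ⟨⟨_, hmem 0 k⟩, hconn⟩ hcomp
    refine ⟨_, _, ?_, hspec.trans (congrArg _ hIcc)⟩
    have m1 := hmem (0, 0) k
    have m2 := hmem (Real.pi, Real.pi) l
    rw [hIcc] at m1 m2
    -- Since ‖V‖ ≤ C ≤ 1, one band value stays at least 3 and another at most −3, hence a < b.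
    have e1 := (abs_le.1 (hpert (0, 0) k)).1
    have e2 := (abs_le.1 (hpert (Real.pi, Real.pi) l)).2
    linarith [m1.2, m2.1]
  · rw [ofReal_mem_spectrum_iff hv] at hE₁ hE₂ hE
    push Not at hE
    obtain ⟨i, hi, θ₁, rfl⟩ := hE₁
    obtain ⟨j, hj, θ₂, rfl⟩ := hE₂
    have hside : ∀ (k : Fin (p * q)) θ η, E < band θ v k → E < band η v k := by
      intro k θ η hlt
      by_contra! hle
      exact hE k ((isPreconnected_bandSet v k).ordConnected.out ⟨k.2, η, rfl⟩ ⟨k.2, θ, rfl⟩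
        ⟨hle, hlt.le⟩)
    have hne : ∀ (k : Fin (p * q)) θ, band θ v k ≠ E := fun k θ h => hE k ⟨k.2, θ, h⟩
    -- Each band lies entirely on one side of `E`. If no consecutive pair straddled it, induction
    -- from index j would put every later band above `E`, and sorting does the same for the earlier
    -- ones; this contradicts `E₁`.
    obtain ⟨n, hn, habove, hbelow⟩ : ∃ n, ∃ hn : n + 1 < p * q,
        (∀ θ, E < band θ v ⟨n, by omega⟩) ∧ ∀ θ, band θ v ⟨n + 1, hn⟩ < E := by
      by_contra! hcon
      have hall : ∀ n, j ≤ n → ∀ hn : n < p * q, ∀ θ, E < band θ v ⟨n, hn⟩ := by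
        intro n hjn
        induction n, hjn using Nat.le_induction with
        | base => exact fun hn θ => hside ⟨j, hn⟩ θ₂ θ h2
        | succ n _ ih =>
          intro hn θ
          obtain ⟨η, hη⟩ := hcon n hn (ih (by omega))
          exact hside ⟨n + 1, hn⟩ η θ (lt_of_le_of_ne hη (hne _ _).symm)
      rcases le_total j i with hji | hij
      · exact lt_asymm h1 (hall i hji hi θ₁)
      · have a1 := band_antitone θ₁ v (show (⟨i, hi⟩ : Fin (p * q)) ≤ ⟨j, hj⟩ from hij)
        have a2 := hall j le_rfl hj θ₁
        linarith
    have ht : IsTouching p q n := by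
      by_contra ht
      obtain ⟨θ, η, hle⟩ := hover n hn ht
      linarith [habove θ, hbelow η]
    rw [abs_le]
    constructor
    -- The free lower band comes arbitrarily close to 0, so the perturbed one, which lies below `E`,
    -- comes within ‖V‖ + ε of 0. The upper band gives the other bound.
    · refine neg_le.1 (le_of_forall_pos_le_add fun ε hε => ?_)
      obtain ⟨θ, hθ⟩ := exists_lt_of_lt_ciSup (ht.iSup_band.symm ▸ neg_lt_zero.2 hε :
        -ε < ⨆ θ, band (p := p) (q := q) θ 0 ⟨n + 1, ht.1⟩)
      have := (abs_le.1 (hpert θ ⟨n + 1, ht.1⟩)).1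
      linarith [hbelow θ]
    · refine le_of_forall_pos_le_add fun ε hε => ?_
      obtain ⟨θ, hθ⟩ := exists_lt_of_ciInf_lt (ht.iInf_band.1.symm ▸ hε :
        (⨅ θ, band (p := p) (q := q) θ 0 ⟨n, _⟩) < ε)
      have := (abs_le.1 (hpert θ ⟨n, by omega⟩)).2
      linarith [habove θ]
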